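/- Let $m\ge 2$ and let $c_1,c_2:\mathbb{R}\to\mathbb{R}$ be smooth functions with $c_1(x)<c_2(x)$ for all $x$. Let $D=\{(x_1,x_2)\in\mathbb{R}^2 : c_1(x_2)<x_1<c_2(x_2)\}$, let $$X=\Big\{(x_1,x_2,y)\in\overline{D}\times\mathbb{R}^{m-1} : (x_1-c_1(x_2))(c_2(x_2)-x_1)-\sum_{j=1}^{m-1}y_j^2=0\Big\}\subset\mathbb{R}^{m+1},$$ an $m$-dimensional smooth submanifold without boundary, and let $f:X\to\mathbb{R}$, $f(x_1,x_2,y)=x_1$. Write $S(c)$ for the set of critical points of a smooth function $c$. A contour of $f$ is a connected component of a level set of $f$; it is critical if it contains a critical point of $f$. The Reeb space $R_f$ is the space of all contours of $f$ with the quotient topology from $X$. A graph (respectively, a graph with ends) is a connected $1$-dimensional cell complex, with the weak topology with respect to the closures of its cells, in which the closure of each $1$-cell (edge) is homeomorphic to $[-1,1]$ (respectively, to $[-1,1]$ or to the ray $[0,\infty)$); its $0$-cells are the vertices. Graphs may be finite or infinite, and an isomorphism is a homeomorphism that maps the vertex set onto the vertex set. Let $q_1,q_2\in\mathbb{R}$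 and suppose: * $(\mathbb{R}\setminus\{q_1,q_2\})\cap\big(c_1(S(c_1))\cup c_2(S(c_2))\big)$ is a discrete and closed subset of $\mathbb{R}\setminus\{q_1,q_2\}$, and $S(c_1)\cup S(c_2)\neq\emptyset$; * $c_1(t)\to q_1$ and $c_2(t)\to q_1$ as $t\to-\infty$, and $c_1(t)\to q_2$ and $c_2(t)\to q_2$ as $t\to+\infty$; * every connected component $K$ of $f^{-1}(q_1)$ or of $f^{-1}(q_2)$ has a compact connected neighbourhood $N_K$ in $X$ that is a union of contours of $f$ and such that $N_K\setminus K$ has only finitely many connected components and contains no critical contour of $f$; and the sets $N_K$ can be chosen mutually disjoint. Then $R_f$, with the critical contours as its vertices, is a graph with ends (the Reeb graph of $f$). It is isomorphic to some graph if and only if the following four conditions hold. 1. Either $S(c_2)$ is unbounded below or $c_2$ is strictly increasing on some interval $(-\infty,b]$; or $S(c_2)$ is bounded below, $c_2$ is not strictly increasing on any interval $(-\infty,b]$, and $S(c_1)$ is unbounded below. 2. Either $S(c_2)$ is unbounded above or $c_2$ is strictly decreasing on some interval $[b,\infty)$; or $S(c_2)$ is bounded above, $c_2$ is not strictly decreasing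 on any interval $[b,\infty)$, and $S(c_1)$ is unbounded above. 3. Either $S(c_1)$ is unbounded below or $-c_1$ is strictly increasing on some interval $(-\infty,b]$; or $S(c_1)$ is bounded below, $-c_1$ is not strictly increasing on any interval $(-\infty,b]$, and $S(c_2)$ is unbounded below. 4. Either $S(c_1)$ is unbounded above or $-c_1$ is strictly decreasing on some interval $[b,\infty)$; or $S(c_1)$ is bounded above, $-c_1$ is not strictly decreasing on any interval $[b,\infty)$, and $S(c_2)$ is unbounded above. -/

import Mathlib

open Set Filter Topology
open scoped ContDiff

namespace ReebStrip

section ReebSpace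

variable {X : Type*} [TopologicalSpace X]

/-- The contour of `f` through `x`: the connected component of `x` in its level set. -/
def contour (f : X → ℝ) (x : X) : Set X :=
  connectedComponentIn (f ⁻¹' {f x}) x

/-- Two points are equivalent if they lie in the same contour. -/
def contourSetoid (f : X → ℝ) : Setoid X :=
  Setoid.ker (contour f)

/-- The Reeb space of `f`: the space of all contours, with the quotient topology. -/
abbrev ReebSpace (f : X → ℝ) : Type _ :=
  Quotient (contourSetoid f)

/-- The points of the Reeb space given by the contours that contain a point of `S`. For `S` the
critical set of `f` these are the critical contours. -/
def contoursMeeting (f : X → ℝ) (S : Set X) : Set (ReebSpace f) :=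
  (fun x => (Quotient.mk (contourSetoid f) x : ReebSpace f)) '' S

/-- The neighbourhood condition at the levels `q₁` and `q₂`, for a function `f` with critical set
`S`: every connected component `K` of the level sets of `q₁` and `q₂` has a compact connected
neighbourhood `N K` that is a union of contours and for which `N K \ K` has only finitely many
connected components and contains no critical contour; and these neighbourhoods are mutually
disjoint. -/
def NeighbourhoodCondition (f : X → ℝ) (S : Set X) (q₁ q₂ : ℝ) : Prop :=
  ∃ N : Set X → Set X,
    (∀ K : Set X, (∃ x, (f x = q₁ ∨ f x = q₂) ∧ K = contour f x) →
      N K ∈ 𝓝ˢ K ∧ IsCompact (N K) ∧ IsConnected (N K) ∧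
      (∀ y ∈ N K, contour f y ⊆ N K) ∧
      {C : Set X | ∃ y ∈ N K \ K, C = connectedComponentIn (N K \ K) y}.Finite ∧
      Disjoint (N K \ K) S) ∧
    (∀ K K' : Set X, (∃ x, (f x = q₁ ∨ f x = q₂) ∧ K = contour f x) →
      (∃ x, (f x = q₁ ∨ f x = q₂) ∧ K' = contour f x) → K ≠ K' → Disjoint (N K) (N K'))

end ReebSpace

section Graphs

/-- The edges (open `1`-cells) of a space `Y` with vertex set (`0`-skeleton) `V`: the connected
components of the complement of `V`. -/
def edges {Y : Type*} [TopologicalSpace Y] (V : Set Y) : Set (Set Y) :=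
  {e | ∃ y ∈ Vᶜ, e = connectedComponentIn Vᶜ y}

/-- `Y` is a connected `1`-dimensional cell complex with vertex set `V`: it is Hausdorff, `V` is
closed and discrete, the components of the complement of `V` are open `1`-cells (and there is at
least one), and `Y` carries the weak topology with respect to the closures of its cells.
That the boundary of an edge lies in `V` is automatic, as an edge is closed in the complement
of `V`. -/
structure IsOneDimComplex (Y : Type*) [TopologicalSpace Y] (V : Set Y) : Prop where
  connected : ConnectedSpace Y
  hausdorff : T2Space Y
  isClosed_vertices : IsClosed V
  discrete_vertices : DiscreteTopology V
  edges_nonempty : (edges V).Nonempty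
  isOpen_edge : ∀ e ∈ edges V, IsOpen e
  edge_homeo : ∀ e ∈ edges V, Nonempty (e ≃ₜ ℝ)
  weak_topology : ∀ A : Set Y, (∀ e ∈ edges V, IsClosed (A ∩ closure e)) → IsClosed A

/-- A graph: the closure of each edge is homeomorphic to the closed interval `D¹`. -/
structure IsGraph (Y : Type*) [TopologicalSpace Y] (V : Set Y) : Prop
    extends IsOneDimComplex Y V where
  closure_edge : ∀ e ∈ edges V, Nonempty (closure e ≃ₜ Icc (-1 : ℝ) 1)

/-- A graph with ends: the closure of each edge is homeomorphic to the closed interval `D¹` or to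
the ray `[0, ∞)`. -/
structure IsGraphWithEnds (Y : Type*) [TopologicalSpace Y] (V : Set Y) : Prop
    extends IsOneDimComplex Y V where
  closure_edge : ∀ e ∈ edges V,
    Nonempty (closure e ≃ₜ Icc (-1 : ℝ) 1) ∨ Nonempty (closure e ≃ₜ Ici (0 : ℝ))

/-- The space `Y` with vertex set `V` is isomorphic to some (finite or infinite) graph: there is a
homeomorphism onto a graph that carries the vertex set onto the vertex set. -/
def IsIsomorphicToGraph (Y : Type) [TopologicalSpace Y] (V : Set Y) : Prop :=
  ∃ (Z : Type) (_ : TopologicalSpace Z) (W : Set Z),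
    IsGraph Z W ∧ ∃ φ : Y ≃ₜ Z, φ '' V = W

end Graphs

section CriticalPoints

/-- The tangent vectors at `p` of a submanifold `M` of a normed space, as the velocities of the
smooth curves in `M` through `p`. -/
def tangentVectors {E : Type*} [NormedAddCommGroup E] [NormedSpace ℝ E] (M : Set E) (p : E) :
    Set E :=
  {v | ∃ ε > (0 : ℝ), ∃ γ : ℝ → E, ContDiffOn ℝ ∞ γ (Ioo (-ε) ε) ∧
    (∀ s ∈ Ioo (-ε) ε, γ s ∈ M) ∧ γ 0 = p ∧ HasDerivAt γ v 0}

/-- The critical points of the restriction of `g` to the submanifold `M`: the points of `M` where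
the differential of `g` vanishes on the tangent space of `M`. -/
def criticalSetOn {E : Type*} [NormedAddCommGroup E] [NormedSpace ℝ E] (M : Set E) (g : E → ℝ) :
    Set M :=
  {p | ∀ v ∈ tangentVectors M (p : E), fderiv ℝ g (p : E) v = 0}

/-- The critical set of a smooth function on the line. -/
def criticalSet (c : ℝ → ℝ) : Set ℝ :=
  {s | deriv c s = 0}

end CriticalPoints

section Strip

/-- `ℝ^(m+1) = ℝ × ℝ × ℝ^(m-1)` (for `m ≥ 1`), with points `(x₁, x₂, y)`. Only its topology and its
smooth structure are used. -/
abbrev Ambient (m : ℕ) : Type :=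
  ℝ × ℝ × (Fin (m - 1) → ℝ)

/-- The region between the graphs of `c₁` and `c₂`. -/
def region (c₁ c₂ : ℝ → ℝ) : Set (ℝ × ℝ) :=
  {x | c₁ x.2 < x.1 ∧ x.1 < c₂ x.2}

/-- The `m`-dimensional submanifold `X_{m,c₁,c₂}` of `ℝ^(m+1)`. -/
def manifoldX (m : ℕ) (c₁ c₂ : ℝ → ℝ) : Set (Ambient m) :=
  {p | (p.1, p.2.1) ∈ closure (region c₁ c₂) ∧
    (p.1 - c₁ p.2.1) * (c₂ p.2.1 - p.1) - ∑ j, p.2.2 j ^ 2 = 0}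

/-- The canonical projection of `ℝ^(m+1)` to the first coordinate. -/
def proj (m : ℕ) (p : Ambient m) : ℝ :=
  p.1

/-- The restriction of the projection to `X_{m,c₁,c₂}`. -/
def projX (m : ℕ) (c₁ c₂ : ℝ → ℝ) (p : manifoldX m c₁ c₂) : ℝ :=
  proj m p

/-- The critical set of the restriction of the projection to `X_{m,c₁,c₂}`. -/
def critX (m : ℕ) (c₁ c₂ : ℝ → ℝ) : Set (manifoldX m c₁ c₂) :=
  criticalSetOn (manifoldX m c₁ c₂) (proj m)

/-- The critical values of `c₁` and `c₂`, as a subset of the line without `q₁` and `q₂`. -/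
def criticalValuesOff (c₁ c₂ : ℝ → ℝ) (q₁ q₂ : ℝ) : Set ({q₁, q₂}ᶜ : Set ℝ) :=
  Subtype.val ⁻¹' (c₁ '' criticalSet c₁ ∪ c₂ '' criticalSet c₂)

end Strip

end ReebStrip

/-! The manifold fibres over the closed strip between the two graphs. The fibre over `(s, x)` is a
sphere of radius `√((s - c₁ x) * (c₂ x - s))`, which shrinks to a point on the boundary curves. A
component of a slice at level `s` is bounded (`exists_not_mem_slice`), so it ends at a boundary
point, where all fibre directions meet. Contours therefore correspond to components of slices, and
the Reeb space is a quotient of the strip (`isSliceQuotient_toReeb`). Critical points are exactly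
the tangencies of horizontal level lines with the boundary curves, so the vertices are the slice
components that contain a tangency.

The hypotheses at `q₁`, `q₂` and the discreteness of the other critical values put every slice
component in a box that isolates it in its slice and has no tangency at another level (`hasBoxes`).
Hence the induced function on the Reeb space is a local homeomorphism to the line off the vertices,
and every point has small compact neighbourhoods cut out by levels
(`IsSliceQuotient.isLevelFunction`). This alone gives a graph with ends: each closed edge is
embedded in the line by its levels, the image is a bounded interval, and edges are locally finite
(`IsLevelFunction.isGraphWithEnds`).

It is isomorphic to a graph exactly when all closed edges are compact
(`forall_isCompact_closure_iff`). If one is not, its levels approach a value `β` that is not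
attained on its closure. The edge must then leave every compact part of the strip, so `β` is the
common limit `q` of `c₁`, `c₂` at `-∞` or `+∞`, and by connectedness the edge swallows the whole
strip near that end. So neither curve has critical points there and both lie on one side of `q`,
which contradicts one of the four conditions. Conversely, if a condition fails, both curves are free
of critical points near an end and one of them is strictly monotone in the forbidden direction.
Following that curve to infinity stays in a single edge and has no limit in the Reeb space. -/

namespace ReebStrip

/-! ### Models of real intervals. -/

section Intervals

theorem nonempty_homeomorph_Icc {a b : ℝ} (h : a < b) :
    Nonempty (Icc a b ≃ₜ Icc (-1 : ℝ) 1) :=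
  ⟨(iccHomeoI a b h).trans (iccHomeoI (-1 : ℝ) 1 (by norm_num)).symm⟩

theorem nonempty_homeomorph_Ioo {a b : ℝ} (h : a < b) : Nonempty (Ioo a b ≃ₜ ℝ) := by
  let φ : ℝ ≃ₜ ℝ := affineHomeomorph ((b - a) / 2) ((a + b) / 2) (by linarith)
  have hφ : φ '' Ioo (-1 : ℝ) 1 = Ioo a b := by
    rw [affineHomeomorph_image_Ioo _ _ _ _ (by linarith)]
    congr 1 <;> ring
  exact ⟨(Homeomorph.setCongr hφ.symm).trans ((φ.image (Ioo (-1 : ℝ) 1)).symm.trans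
    (orderIsoIooNegOneOne ℝ).toHomeomorph.symm)⟩

theorem nonempty_homeomorph_Ico {a b : ℝ} (h : a < b) : Nonempty (Ico a b ≃ₜ Ici (0 : ℝ)) := by
  refine ⟨{
    toFun := fun x => ⟨(x - a) / (b - x), ?_⟩
    invFun := fun u => ⟨(a + u * b) / (1 + u), ?_, ?_⟩
    left_inv := ?_
    right_inv := ?_
    continuous_toFun := ?_
    continuous_invFun := ?_ }⟩
  · obtain ⟨x, hx, hx'⟩ := x
    exact div_nonneg (sub_nonneg.2 hx) (sub_nonneg.2 hx'.le)
  · obtain ⟨u, hu⟩ := u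
    have hu : 0 ≤ u := hu
    rw [le_div_iff₀ (by linarith)]
    dsimp only
    nlinarith
  · obtain ⟨u, hu⟩ := u
    have hu : 0 ≤ u := hu
    rw [div_lt_iff₀ (by linarith)]
    dsimp only
    nlinarith
  · rintro ⟨x, hx, hx'⟩
    have : b - x ≠ 0 := by linarith
    have h2 : b - x + (x - a) ≠ 0 := by linarith
    ext
    dsimp only
    have h3 : b - a ≠ 0 := by linarith
    rw [div_eq_iff (by
      rw [one_add_div this]
      exact div_ne_zero h2 this)]
    field_simp
    ring
  · rintro ⟨u, hu⟩
    have hu : 0 ≤ u := hu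
    have h1 : (1 + u) ≠ 0 := by linarith
    have h3 : b - a ≠ 0 := by linarith
    ext
    dsimp only
    have e1 : (a + u * b) / (1 + u) - a = u * (b - a) / (1 + u) := by field_simp; ring
    have e2 : b - (a + u * b) / (1 + u) = (b - a) / (1 + u) := by field_simp; ring
    rw [e1, e2]
    field_simp
  · refine Continuous.subtype_mk (Continuous.div (by fun_prop) (by fun_prop) ?_) _
    rintro ⟨x, hx, hx'⟩
    exact (sub_pos.2 hx').ne'
  · refine Continuous.subtype_mk (Continuous.div (by fun_prop) (by fun_prop) ?_) _
    rintro ⟨u, hu⟩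
    have hu : 0 ≤ u := hu
    dsimp only
    linarith

theorem nonempty_homeomorph_Ioc {a b : ℝ} (h : a < b) : Nonempty (Ioc a b ≃ₜ Ici (0 : ℝ)) := by
  have e : (Homeomorph.neg ℝ) '' Ioc a b = Ico (-b) (-a) := by
    simp
  obtain ⟨ψ⟩ := nonempty_homeomorph_Ico (neg_lt_neg h)
  exact ⟨((Homeomorph.neg ℝ).image (Ioc a b)).trans ((Homeomorph.setCongr e).trans ψ)⟩

/-- A bounded set of reals that is open, preconnected and non-empty is an open interval. -/
theorem exists_eq_Ioo {s : Set ℝ} (ho : IsOpen s) (hc : s.OrdConnected) (hne : s.Nonempty)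
    (hb : BddBelow s) (ha : BddAbove s) : ∃ a b, a < b ∧ s = Ioo a b := by
  have h1 : s ⊆ Ioo (sInf s) (sSup s) := by
    intro x hx
    obtain ⟨ε, hε, hs⟩ := Metric.isOpen_iff.1 ho x hx
    have m1 : x - ε / 2 ∈ s := hs (by simp [abs_of_pos hε, hε.lt])
    have m2 : x + ε / 2 ∈ s := hs (by simp [abs_of_pos hε, hε.lt])
    exact ⟨by linarith [csInf_le hb m1], by linarith [le_csSup ha m2]⟩
  refine ⟨sInf s, sSup s, ?_, h1.antisymm ?_⟩
  · obtain ⟨x, hx⟩ := hne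
    exact (h1 hx).1.trans (h1 hx).2
  · rintro x ⟨hx, hx'⟩
    obtain ⟨u, hu, hux⟩ := exists_lt_of_csInf_lt hne hx
    obtain ⟨v, hv, hxv⟩ := exists_lt_of_lt_csSup hne hx'
    exact hc.out hu hv ⟨hux.le, hxv.le⟩

end Intervals

/-! ### Edges as seen by a level function: openness, injectivity, embedding of closures. -/

section LevelFunction

variable {Y : Type*} [TopologicalSpace Y]

/-- A continuous function `f` that is locally injective and open off `V`, and such that every point
`y` has arbitrarily small compact neighbourhoods that meet `V` and the level of `y` at most in `y`
and are open relative to the nearby levels. -/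
structure IsLevelFunction (f : Y → ℝ) (V : Set Y) : Prop where
  continuous : Continuous f
  isOpen_image : ∀ O, IsOpen O → O ⊆ Vᶜ → IsOpen (f '' O)
  exists_injOn : ∀ y ∈ Vᶜ, ∃ U, IsOpen U ∧ y ∈ U ∧ U ⊆ Vᶜ ∧ IsPreconnected U ∧ InjOn f U
  exists_box : ∀ y, ∀ O ∈ 𝓝 y, ∃ C : Set Y, ∃ δ > 0, IsCompact C ∧ y ∈ C ∧ C ⊆ O ∧
    C ∩ V ⊆ {y} ∧ C ∩ f ⁻¹' {f y} ⊆ {y} ∧ IsOpen (C ∩ f ⁻¹' Ioo (f y - δ) (f y + δ))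

namespace IsLevelFunction

variable {f : Y → ℝ} {V : Set Y}

theorem exists_open_box (h : IsLevelFunction f V) (y : Y) :
    ∃ U, IsOpen U ∧ y ∈ U ∧ U ∩ V ⊆ {y} := by
  obtain ⟨C, δ, hδ, -, hy, -, hV, -, ho⟩ := h.exists_box y univ univ_mem
  exact ⟨_, ho, ⟨hy, by simp [hδ]⟩, fun z hz => hV ⟨hz.1.1, hz.2⟩⟩

theorem isClosed_vertices [T1Space Y] (h : IsLevelFunction f V) : IsClosed V := by
  rw [← isOpen_compl_iff, isOpen_iff_mem_nhds]
  intro y hy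
  obtain ⟨U, hU, hyU, hV⟩ := h.exists_open_box y
  filter_upwards [hU.mem_nhds hyU] with z hz hzV
  obtain rfl : z = y := hV ⟨hz, hzV⟩
  exact hy hzV

theorem discrete_vertices (h : IsLevelFunction f V) : DiscreteTopology V := by
  rw [discreteTopology_subtype_iff']
  intro y hy
  obtain ⟨U, hU, hyU, hV⟩ := h.exists_open_box y
  exact ⟨U, hU, hV.antisymm (by simpa using ⟨hyU, hy⟩)⟩

/-- The common levels form an interval, and those attained on `U₁ ∩ U₂` form a non-empty open part
of it. This part is also relatively closed: if a limit level `s` were attained at distinct points of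
`U₁` and `U₂`, disjoint neighbourhoods of them would both have images containing all levels near
`s`, and a point of `U₁ ∩ U₂` at such a level would lie in both. -/
theorem injOn_union [T2Space Y] (h : IsLevelFunction f V) {U₁ U₂ : Set Y} (ho₁ : IsOpen U₁)
    (ho₂ : IsOpen U₂) (hV₁ : U₁ ⊆ Vᶜ) (hV₂ : U₂ ⊆ Vᶜ) (hc₁ : IsPreconnected U₁)
    (hc₂ : IsPreconnected U₂) (hi₁ : InjOn f U₁) (hi₂ : InjOn f U₂) (hne : (U₁ ∩ U₂).Nonempty) :
    InjOn f (U₁ ∪ U₂) := by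
  have hpre : IsPreconnected (f '' U₁ ∩ f '' U₂) := by
    have o₁ := (hc₁.image f h.continuous.continuousOn).ordConnected
    have o₂ := (hc₂.image f h.continuous.continuousOn).ordConnected
    exact (o₁.inter o₂).isPreconnected
  have hsub : f '' U₁ ∩ f '' U₂ ⊆ f '' (U₁ ∩ U₂) := by
    refine hpre.subset_of_closure_inter_subset
      (h.isOpen_image _ (ho₁.inter ho₂) (inter_subset_left.trans hV₁)) ?_ ?_
    · obtain ⟨y, hy⟩ := hne
      exact ⟨f y, ⟨⟨y, hy.1, rfl⟩, ⟨y, hy.2, rfl⟩⟩, ⟨y, hy, rfl⟩⟩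
    · rintro s ⟨hs, ⟨u₁, hu₁, h₁⟩, ⟨u₂, hu₂, h₂⟩⟩
      by_contra hcon
      have hne : u₁ ≠ u₂ := by
        rintro rfl
        exact hcon ⟨u₁, ⟨hu₁, hu₂⟩, h₁⟩
      obtain ⟨O₁, O₂, hO₁, hO₂, hm₁, hm₂, hd⟩ := t2_separation hne
      have hN : f '' (U₁ ∩ O₁) ∩ f '' (U₂ ∩ O₂) ∈ 𝓝 s :=
        inter_mem
          ((h.isOpen_image _ (ho₁.inter hO₁) (inter_subset_left.trans hV₁)).mem_nhds
            ⟨u₁, ⟨hu₁, hm₁⟩, h₁⟩)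
          ((h.isOpen_image _ (ho₂.inter hO₂) (inter_subset_left.trans hV₂)).mem_nhds
            ⟨u₂, ⟨hu₂, hm₂⟩, h₂⟩)
      obtain ⟨s', ⟨⟨w₁, hw₁, e₁⟩, ⟨w₂, hw₂, e₂⟩⟩, ⟨w, hw, e⟩⟩ := mem_closure_iff_nhds.1 hs _ hN
      have a₁ : w = w₁ := hi₁ hw.1 hw₁.1 (e.trans e₁.symm)
      have a₂ : w = w₂ := hi₂ hw.2 hw₂.1 (e.trans e₂.symm)
      exact disjoint_left.1 hd (a₁ ▸ hw₁.2) (a₂ ▸ hw₂.2)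
  have key : ∀ u₁ ∈ U₁, ∀ u₂ ∈ U₂, f u₁ = f u₂ → u₁ = u₂ := by
    intro u₁ hu₁ u₂ hu₂ he
    obtain ⟨w, hw, e⟩ := hsub ⟨⟨u₁, hu₁, rfl⟩, ⟨u₂, hu₂, he.symm⟩⟩
    rw [← hi₁ hw.1 hu₁ e, ← hi₂ hw.2 hu₂ (e.trans he)]
  rintro u (hu | hu) v (hv | hv) huv
  · exact hi₁ hu hv huv
  · exact key u hu v hv huv
  · exact (key v hv u hu huv.symm).symm
  · exact hi₂ hu hv huv

/-- By `injOn_union`, the union of all connected open sets through `y` off `V` on which `f` is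
injective is again such a set. Any point of the component in its closure has a neighbourhood that
can be added to it, so the union is the whole component. -/
theorem isOpen_and_injOn_edge [T2Space Y] (h : IsLevelFunction f V) {e : Set Y}
    (he : e ∈ edges V) : IsOpen e ∧ InjOn f e := by
  obtain ⟨y, hy, rfl⟩ := he
  set 𝓤 : Set (Set Y) := {U | IsOpen U ∧ y ∈ U ∧ U ⊆ Vᶜ ∧ IsPreconnected U ∧ InjOn f U} with h𝓤
  have hopen : IsOpen (⋃₀ 𝓤) := isOpen_sUnion fun U hU => hU.1
  have hpre : IsPreconnected (⋃₀ 𝓤) :=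
    isPreconnected_sUnion y 𝓤 (fun U hU => hU.2.1) fun U hU => hU.2.2.2.1
  have hsub : ⋃₀ 𝓤 ⊆ Vᶜ := sUnion_subset fun U hU => hU.2.2.1
  have hinj : InjOn f (⋃₀ 𝓤) := by
    rintro u ⟨U, hU, hu⟩ v ⟨W, hW, hv⟩ huv
    exact h.injOn_union hU.1 hW.1 hU.2.2.1 hW.2.2.1 hU.2.2.2.1 hW.2.2.2.1 hU.2.2.2.2 hW.2.2.2.2
      ⟨y, hU.2.1, hW.2.1⟩ (Or.inl hu) (Or.inr hv) huv
  obtain ⟨U₀, hU₀⟩ := h.exists_injOn y hy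
  have hyU : y ∈ ⋃₀ 𝓤 := ⟨U₀, hU₀, hU₀.2.1⟩
  have heq : connectedComponentIn Vᶜ y = ⋃₀ 𝓤 := by
    refine Subset.antisymm ?_ (hpre.subset_connectedComponentIn hyU hsub)
    refine isPreconnected_connectedComponentIn.subset_of_closure_inter_subset hopen
      ⟨y, mem_connectedComponentIn hy, hyU⟩ ?_
    rintro w ⟨hw, hw'⟩
    obtain ⟨W, hWo, hwW, hWV, hWc, hWi⟩ := h.exists_injOn w (connectedComponentIn_subset _ _ hw')
    have hne : (⋃₀ 𝓤 ∩ W).Nonempty := by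
      obtain ⟨z, hz⟩ := mem_closure_iff.1 hw W hWo hwW
      exact ⟨z, hz.2, hz.1⟩
    obtain ⟨z, hz⟩ := hne
    exact ⟨⋃₀ 𝓤 ∪ W, ⟨hopen.union hWo, Or.inl hyU, union_subset hsub hWV,
      hpre.union z hz.1 hz.2 hWc, h.injOn_union hopen hWo hsub hWV hpre hWc hinj hWi ⟨z, hz⟩⟩,
      Or.inr hwW⟩
  rw [heq]
  exact ⟨hopen, hinj⟩

end IsLevelFunction

theorem edge_subset_compl {V e : Set Y} (he : e ∈ edges V) : e ⊆ Vᶜ := by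
  obtain ⟨y, -, rfl⟩ := he
  exact connectedComponentIn_subset _ _

theorem isPreconnected_edge {V e : Set Y} (he : e ∈ edges V) : IsPreconnected e := by
  obtain ⟨y, -, rfl⟩ := he
  exact isPreconnected_connectedComponentIn

theorem edge_nonempty {V e : Set Y} (he : e ∈ edges V) : e.Nonempty := by
  obtain ⟨y, hy, rfl⟩ := he
  exact ⟨y, mem_connectedComponentIn hy⟩

theorem subset_edge {V e s : Set Y} (he : e ∈ edges V) (hs : IsPreconnected s) (hsV : s ⊆ Vᶜ)
    (hne : (s ∩ e).Nonempty) : s ⊆ e := by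
  obtain ⟨y, hy, rfl⟩ := he
  obtain ⟨z, hz, hz'⟩ := hne
  rw [connectedComponentIn_eq hz']
  exact hs.subset_connectedComponentIn hz hsV

theorem closure_edge_diff_subset {V e : Set Y} (he : e ∈ edges V) : closure e ∩ Vᶜ ⊆ e := by
  obtain ⟨z, hz⟩ := edge_nonempty he
  exact subset_edge he ((isPreconnected_edge he).subset_closure
    (fun y hy => ⟨subset_closure hy, edge_subset_compl he hy⟩) inter_subset_left)
    inter_subset_right ⟨z, ⟨subset_closure hz, edge_subset_compl he hz⟩, hz⟩

namespace IsLevelFunction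

variable {f : Y → ℝ} {V e : Set Y} [T2Space Y]

/-- On an edge `f` is an open embedding into the line, so this set is a copy of an intersection of
two intervals. -/
theorem isPreconnected_edge_inter (h : IsLevelFunction f V) (he : e ∈ edges V) {J : Set ℝ}
    (hJ : J.OrdConnected) : IsPreconnected (e ∩ f ⁻¹' J) := by
  obtain ⟨ho, hi⟩ := h.isOpen_and_injOn_edge he
  have himg : IsPreconnected (f '' e ∩ J) :=
    (((isPreconnected_edge he).image f h.continuous.continuousOn).ordConnected.inter
      hJ).isPreconnected
  have hemb : IsOpenEmbedding (e.domRestrict f) := by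
    refine .of_continuous_injective_isOpenMap (h.continuous.comp continuous_subtype_val)
      (injOn_iff_injective.1 hi) fun O hO => ?_
    have := h.isOpen_image (Subtype.val '' O) (ho.isOpenEmbedding_subtypeVal.isOpenMap O hO)
      ((Subtype.coe_image_subset e O).trans (edge_subset_compl he))
    rwa [image_image] at this
  have hpre : IsPreconnected (e.domRestrict f ⁻¹' (f '' e ∩ J)) := by
    refine (hemb.isInducing.isPreconnected_image).1 ?_
    rw [image_preimage_eq_of_subset]
    · exact himg
    · rw [range_domRestrict]
      exact inter_subset_left
  have := hpre.image Subtype.val continuous_subtype_val.continuousOn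
  convert this using 1
  ext y
  constructor
  · rintro ⟨hy, hyJ⟩
    exact ⟨⟨y, hy⟩, ⟨⟨y, hy, rfl⟩, hyJ⟩, rfl⟩
  · rintro ⟨⟨z, hz⟩, hzJ, rfl⟩
    exact ⟨hz, hzJ.2⟩

/-- Along an edge, the levels near that of a limit point determine a small neighbourhood. -/
theorem exists_forall_mem_of_closure (h : IsLevelFunction f V) (he : e ∈ edges V) {v : Y}
    (hv : v ∈ closure e) {O : Set Y} (hO : O ∈ 𝓝 v) :
    ∃ δ > 0, ∀ w ∈ closure e, |f w - f v| < δ → w ∈ O := by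
  obtain ⟨C, δ, hδ, hC, hvC, hCO, -, -, ho⟩ := h.exists_box v O hO
  refine ⟨δ, hδ, fun w hw hwv => hCO ?_⟩
  have hpre := h.isPreconnected_edge_inter he (J := Ioo (f v - δ) (f v + δ)) ordConnected_Ioo
  have hvo : v ∈ C ∩ f ⁻¹' Ioo (f v - δ) (f v + δ) := ⟨hvC, by simp [hδ]⟩
  -- The box is open, and it is closed relative to these levels because `C` is compact. The
  -- connected piece of the edge meets it near `v`, so it cannot leave it.
  have hsub : e ∩ f ⁻¹' Ioo (f v - δ) (f v + δ) ⊆ C ∩ f ⁻¹' Ioo (f v - δ) (f v + δ) := by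
    refine hpre.subset_of_closure_inter_subset ho ?_ ?_
    · obtain ⟨z, hz, hze⟩ := mem_closure_iff.1 hv _ ho hvo
      exact ⟨z, ⟨hze, hz.2⟩, hz⟩
    · rintro z ⟨hz, hz'⟩
      exact ⟨hC.isClosed.closure_subset_iff.2 inter_subset_left hz, hz'.2⟩
  rw [← hC.isClosed.closure_eq]
  have hwo : IsOpen (f ⁻¹' Ioo (f v - δ) (f v + δ)) := isOpen_Ioo.preimage h.continuous
  have hwm : w ∈ f ⁻¹' Ioo (f v - δ) (f v + δ) := by
    rw [abs_lt] at hwv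
    constructor <;> linarith
  refine closure_mono ?_ (hwo.inter_closure ⟨hwm, hw⟩)
  rw [inter_comm]
  exact hsub.trans inter_subset_left

/-- Otherwise the neighbourhood `{w}ᶜ` of `v` would have to contain `w`, which is in the closure at
the level of `v`. -/
theorem injOn_closure_edge (h : IsLevelFunction f V) (he : e ∈ edges V) :
    InjOn f (closure e) := by
  intro v hv w hw hvw
  by_contra hne
  obtain ⟨δ, hδ, H⟩ := h.exists_forall_mem_of_closure he hv (isOpen_ne.mem_nhds hne)
  exact H w hw (by simpa [hvw] using hδ) rfl

theorem isEmbedding_restrict_closure (h : IsLevelFunction f V) (he : e ∈ edges V) :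
    IsEmbedding ((closure e).domRestrict f) := by
  refine ⟨⟨?_⟩, injOn_iff_injective.1 (h.injOn_closure_edge he)⟩
  refine le_antisymm (h.continuous.comp continuous_subtype_val).le_induced ?_
  rw [TopologicalSpace.le_def]
  intro O hO
  rw [@isOpen_iff_mem_nhds]
  rintro ⟨v, hv⟩ hvO
  obtain ⟨O', hO', rfl⟩ := isOpen_induced_iff.1 hO
  obtain ⟨δ, hδ, H⟩ := h.exists_forall_mem_of_closure he hv (hO'.mem_nhds hvO)
  rw [nhds_induced]
  refine ⟨Metric.ball (f v) δ, Metric.ball_mem_nhds _ hδ, ?_⟩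
  rintro ⟨w, hw⟩ hwv
  exact H w hw (by simpa [Real.dist_eq] using hwv)

end IsLevelFunction

end LevelFunction

/-! ### From level functions to graphs with ends, and compactness of closed edges. -/

section LevelFunction

namespace IsLevelFunction

variable {Y : Type*} [TopologicalSpace Y] {f : Y → ℝ} {V e : Set Y}

theorem image_closure_edge_subset (h : IsLevelFunction f V) {a b : ℝ} (hab : a < b)
    (himg : f '' e = Ioo a b) : f '' closure e ⊆ Icc a b := by
  rw [← closure_Ioo hab.ne, ← himg]
  exact image_closure_subset_closure_image h.continuous

/-- Local injectivity off `V` makes this compact set discrete. -/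
theorem finite_level_inter (h : IsLevelFunction f V) {C : Set Y} (hC : IsCompact C) {s : ℝ}
    (hd : Disjoint (C ∩ f ⁻¹' {s}) V) : (C ∩ f ⁻¹' {s}).Finite := by
  refine (hC.inter_right (isClosed_singleton.preimage h.continuous)).finite ?_
  rw [isDiscrete_iff_discreteTopology, discreteTopology_subtype_iff']
  intro y hy
  obtain ⟨U, hU, hyU, -, -, hinj⟩ := h.exists_injOn y (disjoint_left.1 hd hy)
  refine ⟨U, hU, Subset.antisymm ?_ (by simpa using ⟨hyU, hy⟩)⟩
  rintro z ⟨hz, hz'⟩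
  exact hinj hz hyU (hz'.2.trans hy.2.symm)

variable [T2Space Y]

theorem exists_image_edge_eq_Ioo (h : IsLevelFunction f V) (hb : BddBelow (range f))
    (ha : BddAbove (range f)) (he : e ∈ edges V) : ∃ a b, a < b ∧ f '' e = Ioo a b :=
  exists_eq_Ioo (h.isOpen_image e (h.isOpen_and_injOn_edge he).1 (edge_subset_compl he))
    ((isPreconnected_edge he).image f h.continuous.continuousOn).ordConnected
    ((edge_nonempty he).image f) (hb.mono (image_subset_range _ _))
    (ha.mono (image_subset_range _ _))

theorem nonempty_homeomorph_edge (h : IsLevelFunction f V) (hb : BddBelow (range f))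
    (ha : BddAbove (range f)) (he : e ∈ edges V) : Nonempty (e ≃ₜ ℝ) := by
  obtain ⟨a, b, hab, himg⟩ := h.exists_image_edge_eq_Ioo hb ha he
  have hemb : IsEmbedding (e.domRestrict f) :=
    (h.isEmbedding_restrict_closure he).comp (IsEmbedding.inclusion subset_closure)
  have hr : range (e.domRestrict f) = Ioo a b := by rw [range_domRestrict, himg]
  obtain ⟨ψ⟩ := nonempty_homeomorph_Ioo hab
  exact ⟨hemb.toHomeomorph.trans ((Homeomorph.setCongr hr).trans ψ)⟩

/-- The closure of an edge is carried homeomorphically onto its levels. -/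
theorem nonempty_homeomorph_closure_edge (h : IsLevelFunction f V) (he : e ∈ edges V) :
    Nonempty (closure e ≃ₜ f '' closure e) :=
  ⟨(h.isEmbedding_restrict_closure he).toHomeomorph.trans
    (Homeomorph.setCongr (range_domRestrict _ _))⟩

theorem nonempty_homeomorph_closure [ConnectedSpace Y] (h : IsLevelFunction f V)
    (hV : V.Nonempty) (hb : BddBelow (range f)) (ha : BddAbove (range f)) (he : e ∈ edges V) :
    Nonempty (closure e ≃ₜ Icc (-1 : ℝ) 1) ∨ Nonempty (closure e ≃ₜ Ici (0 : ℝ)) := by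
  obtain ⟨a, b, hab, himg⟩ := h.exists_image_edge_eq_Ioo hb ha he
  obtain ⟨φ⟩ := h.nonempty_homeomorph_closure_edge he
  have hsub := h.image_closure_edge_subset hab himg
  have hsup : Ioo a b ⊆ f '' closure e := himg ▸ image_mono subset_closure
  by_cases h1 : a ∈ f '' closure e <;> by_cases h2 : b ∈ f '' closure e
  · have heq : f '' closure e = Icc a b := by
      refine hsub.antisymm ?_
      rw [← Ioo_union_both hab.le]
      exact union_subset hsup (by rintro x (rfl | rfl) <;> assumption)
    obtain ⟨ψ⟩ := nonempty_homeomorph_Icc hab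
    exact Or.inl ⟨φ.trans ((Homeomorph.setCongr heq).trans ψ)⟩
  · have heq : f '' closure e = Ico a b := by
      refine Subset.antisymm (fun x hx => ⟨(hsub hx).1, (hsub hx).2.lt_of_ne ?_⟩) ?_
      · rintro rfl
        exact h2 hx
      · rw [← Ioo_union_left hab]
        exact union_subset hsup (by rintro x rfl; assumption)
    obtain ⟨ψ⟩ := nonempty_homeomorph_Ico hab
    exact Or.inr ⟨φ.trans ((Homeomorph.setCongr heq).trans ψ)⟩
  · have heq : f '' closure e = Ioc a b := by
      refine Subset.antisymm (fun x hx => ⟨(hsub hx).1.lt_of_ne ?_, (hsub hx).2⟩) ?_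
      · rintro rfl
        exact h1 hx
      · rw [← Ioo_union_right hab]
        exact union_subset hsup (by rintro x rfl; assumption)
    obtain ⟨ψ⟩ := nonempty_homeomorph_Ioc hab
    exact Or.inr ⟨φ.trans ((Homeomorph.setCongr heq).trans ψ)⟩
  -- With neither extreme level attained, the edge is closed as well as open, hence the whole space,
  -- and leaves no room for a vertex.
  · exfalso
    have hcl : closure e ⊆ e := by
      intro y hy
      have hfy : f y ∈ f '' e := by
        rw [himg]
        refine ⟨(hsub ⟨y, hy, rfl⟩).1.lt_of_ne ?_, (hsub ⟨y, hy, rfl⟩).2.lt_of_ne ?_⟩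
        · rintro rfl
          exact h1 ⟨y, hy, rfl⟩
        · rintro rfl
          exact h2 ⟨y, hy, rfl⟩
      obtain ⟨z, hz, hzy⟩ := hfy
      rwa [← h.injOn_closure_edge he (subset_closure hz) hy hzy]
    have huniv : e = univ :=
      IsClopen.eq_univ ⟨isClosed_of_closure_subset hcl, (h.isOpen_and_injOn_edge he).1⟩
        (edge_nonempty he)
    obtain ⟨v, hv⟩ := hV
    exact edge_subset_compl he (huniv ▸ mem_univ v) hv

/-- Near a point `y` at level `t`, an edge that comes close to `y` passes through all levels close
to `t` on one side. -/
theorem subset_image_edge_inter (h : IsLevelFunction f V) (he : e ∈ edges V) {y : Y} {C : Set Y}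
    {δ : ℝ} (hC : IsCompact C) (hCV : C ∩ V ⊆ {y})
    (ho : IsOpen (C ∩ f ⁻¹' Ioo (f y - δ) (f y + δ))) {J : Set ℝ} (hJo : IsOpen J)
    (hJ : J.OrdConnected) (hJδ : J ⊆ Ioo (f y - δ) (f y + δ)) (hJy : f y ∉ J)
    (hne : (e ∩ C ∩ f ⁻¹' J).Nonempty) : J ⊆ f '' (e ∩ C) := by
  have hopen : IsOpen (f '' (e ∩ (C ∩ f ⁻¹' Ioo (f y - δ) (f y + δ)) ∩ f ⁻¹' J)) :=
    h.isOpen_image _ (((h.isOpen_and_injOn_edge he).1.inter ho).inter (hJo.preimage h.continuous))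
      fun z hz => edge_subset_compl he hz.1.1
  have hsub : J ⊆ f '' (e ∩ (C ∩ f ⁻¹' Ioo (f y - δ) (f y + δ)) ∩ f ⁻¹' J) := by
    refine hJ.isPreconnected.subset_of_closure_inter_subset hopen ?_ ?_
    · obtain ⟨z, ⟨hz, hzC⟩, hzJ⟩ := hne
      exact ⟨f z, hzJ, z, ⟨⟨hz, hzC, hJδ hzJ⟩, hzJ⟩, rfl⟩
    -- A limit level in `J` is attained on the compact set `closure e ∩ C`. The point attaining it
    -- is not a vertex, because the only possible vertex in `C` is `y` and `f y ∉ J`; so it lies on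
    -- `e`.
    · rintro s ⟨hs, hsJ⟩
      have hcpt : IsClosed (f '' (closure e ∩ C)) :=
        ((hC.inter_left isClosed_closure).image h.continuous).isClosed
      obtain ⟨v, ⟨hve, hvC⟩, rfl⟩ := hcpt.closure_subset_iff.2 (by
        rintro _ ⟨z, hz, rfl⟩
        exact ⟨z, ⟨subset_closure hz.1.1, hz.1.2.1⟩, rfl⟩) hs
      have hvV : v ∉ V := by
        intro hvV
        obtain rfl : v = y := hCV ⟨hvC, hvV⟩
        exact hJy hsJ
      exact ⟨v, ⟨⟨closure_edge_diff_subset he ⟨hve, hvV⟩, hvC, hJδ hsJ⟩, hsJ⟩, rfl⟩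
  refine hsub.trans (image_mono ?_)
  rintro z ⟨⟨hz, hzC, -⟩, -⟩
  exact ⟨hz, hzC⟩

/-- Every point has a neighbourhood that meets only finitely many edges. -/
theorem exists_finite_edges (h : IsLevelFunction f V) (y : Y) :
    ∃ U, IsOpen U ∧ y ∈ U ∧ ∃ F : Set (Set Y), F.Finite ∧ F ⊆ edges V ∧ U ⊆ {y} ∪ ⋃₀ F := by
  obtain ⟨C, δ, hδ, hC, hyC, -, hCV, hCy, ho⟩ := h.exists_box y univ univ_mem
  have hfin : ∀ s, s ≠ f y → (C ∩ f ⁻¹' {s}).Finite := by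
    intro s hs
    refine h.finite_level_inter hC (disjoint_left.2 ?_)
    rintro z ⟨hzC, hzs⟩ hzV
    obtain rfl : z = y := hCV ⟨hzC, hzV⟩
    exact hs hzs.symm
  -- Every edge that enters the box must cross one of these two levels inside `C`, and `D` is
  -- finite; so finitely many edges enter.
  set D := C ∩ f ⁻¹' {f y + δ / 2} ∪ C ∩ f ⁻¹' {f y - δ / 2} with hD
  have hDfin : D.Finite := (hfin _ (by linarith)).union (hfin _ (by linarith))
  have hDV : D ⊆ Vᶜ := by
    rintro z hz hzV
    obtain rfl : z = y := hCV ⟨hz.elim And.left And.left, hzV⟩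
    rcases hz with ⟨-, hz⟩ | ⟨-, hz⟩
    · have : f z = f z + δ / 2 := hz
      linarith
    · have : f z = f z - δ / 2 := hz
      linarith
  refine ⟨_, ho, ⟨hyC, by simp [hδ]⟩, connectedComponentIn Vᶜ '' D, hDfin.image _, ?_, ?_⟩
  · rintro _ ⟨z, hz, rfl⟩
    exact ⟨z, hDV hz, rfl⟩
  rintro w ⟨hwC, hw1, hw2⟩
  by_cases hwy : w = y
  · exact Or.inl hwy
  right
  have hwV : w ∈ Vᶜ := fun hwV => hwy (hCV ⟨hwC, hwV⟩)
  have hfw : f w ≠ f y := fun hfw => hwy (hCy ⟨hwC, hfw⟩)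
  set e := connectedComponentIn Vᶜ w with he
  have hedge : e ∈ edges V := ⟨w, hwV, rfl⟩
  have hwe : w ∈ e := mem_connectedComponentIn hwV
  have hz : ∃ z ∈ D, z ∈ e := by
    rcases hfw.lt_or_gt with hlt | hlt
    · obtain ⟨z, hz, hfz⟩ := h.subset_image_edge_inter hedge hC hCV ho
        (J := Ioo (f y - δ) (f y)) isOpen_Ioo ordConnected_Ioo
        (Ioo_subset_Ioo_right (by linarith)) (by simp) ⟨w, ⟨hwe, hwC⟩, hw1, hlt⟩
        (show f y - δ / 2 ∈ _ by constructor <;> linarith)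
      exact ⟨z, Or.inr ⟨hz.2, hfz⟩, hz.1⟩
    · obtain ⟨z, hz, hfz⟩ := h.subset_image_edge_inter hedge hC hCV ho
        (J := Ioo (f y) (f y + δ)) isOpen_Ioo ordConnected_Ioo
        (Ioo_subset_Ioo_left (by linarith)) (by simp) ⟨w, ⟨hwe, hwC⟩, hlt, hw2⟩
        (show f y + δ / 2 ∈ _ by constructor <;> linarith)
      exact ⟨z, Or.inl ⟨hz.2, hfz⟩, hz.1⟩
  obtain ⟨z, hzD, hze⟩ := hz
  refine ⟨connectedComponentIn Vᶜ z, ⟨z, hzD, rfl⟩, ?_⟩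
  rw [← connectedComponentIn_eq hze]
  exact hwe

/-- Local finiteness: near a point outside `A`, the set `A` is covered by finitely many of the
closed sets `A ∩ closure e`. -/
theorem isClosed_of_inter_closure_edge (h : IsLevelFunction f V) (A : Set Y)
    (hA : ∀ e ∈ edges V, IsClosed (A ∩ closure e)) : IsClosed A := by
  refine isClosed_of_closure_subset fun y hy => ?_
  by_contra hyA
  obtain ⟨U, hU, hyU, F, hF, hFe, hsub⟩ := h.exists_finite_edges y
  have hcl : IsClosed (⋃ e ∈ F, A ∩ closure e) := hF.isClosed_biUnion fun e he => hA e (hFe he)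
  have hmem : y ∈ closure (⋃ e ∈ F, A ∩ closure e) := by
    refine closure_mono ?_ (hU.inter_closure ⟨hyU, hy⟩)
    rintro z ⟨hzU, hzA⟩
    rcases hsub hzU with rfl | ⟨e, he, hze⟩
    · exact absurd hzA hyA
    · exact mem_biUnion he ⟨hzA, subset_closure hze⟩
  rw [hcl.closure_eq] at hmem
  simp only [mem_iUnion] at hmem
  obtain ⟨e, -, hyA', -⟩ := hmem
  exact hyA hyA'

theorem isGraphWithEnds [ConnectedSpace Y] (h : IsLevelFunction f V) (hV : V.Nonempty)
    (hb : BddBelow (range f)) (ha : BddAbove (range f)) {y z : Y} (hyz : f y ≠ f z) :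
    IsGraphWithEnds Y V where
  connected := inferInstance
  hausdorff := inferInstance
  isClosed_vertices := h.isClosed_vertices
  discrete_vertices := h.discrete_vertices
  edges_nonempty := by
    -- Without edges every point would be a vertex, so `{y}` would be clopen in a connected space
    -- with two levels.
    by_contra hcon
    have hVuniv : ∀ w, w ∈ V := by
      intro w
      by_contra hw
      exact hcon ⟨_, w, hw, rfl⟩
    obtain ⟨U, hU, hyU, hUV⟩ := h.exists_open_box y
    have hUy : U = {y} :=
      Subset.antisymm (fun w hw => hUV ⟨hw, hVuniv w⟩) (singleton_subset_iff.2 hyU)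
    have huniv : ({y} : Set Y) = univ :=
      IsClopen.eq_univ ⟨isClosed_singleton, hUy ▸ hU⟩ (singleton_nonempty y)
    have : z ∈ ({y} : Set Y) := huniv ▸ mem_univ z
    exact hyz (congrArg f this).symm
  isOpen_edge e he := (h.isOpen_and_injOn_edge he).1
  edge_homeo e he := h.nonempty_homeomorph_edge hb ha he
  weak_topology := h.isClosed_of_inter_closure_edge
  closure_edge e he := h.nonempty_homeomorph_closure hV hb ha he

/-- An edge whose closure is not compact has an end, whose level is not attained on the closure. -/
theorem exists_end_of_not_isCompact (h : IsLevelFunction f V) (hb : BddBelow (range f))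
    (ha : BddAbove (range f)) (he : e ∈ edges V) (hc : ¬ IsCompact (closure e)) :
    ∃ β, β ∉ f '' closure e ∧ β ∈ closure (f '' e) := by
  by_contra! hcon
  apply hc
  have hcl : IsClosed (f '' closure e) := by
    refine isClosed_of_closure_subset fun β hβ => ?_
    by_contra hβ'
    refine hcon β hβ' (closure_minimal ?_ isClosed_closure hβ)
    exact image_closure_subset_closure_image h.continuous
  have hcpt : IsCompact (f '' closure e) :=
    Metric.isCompact_of_isClosed_isBounded hcl (isBounded_iff_bddBelow_bddAbove.2
      ⟨hb.mono (image_subset_range _ _), ha.mono (image_subset_range _ _)⟩)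
  obtain ⟨φ⟩ := h.nonempty_homeomorph_closure_edge he
  rw [isCompact_iff_compactSpace] at hcpt ⊢
  exact φ.symm.compactSpace

end IsLevelFunction

theorem IsGraph.isCompact_closure {Y : Type*} [TopologicalSpace Y] {V e : Set Y}
    (h : IsGraph Y V) (he : e ∈ edges V) : IsCompact (closure e) := by
  obtain ⟨φ⟩ := h.closure_edge e he
  rw [isCompact_iff_compactSpace]
  exact φ.symm.compactSpace

theorem not_compactSpace_Ici_zero : ¬ CompactSpace (Ici (0 : ℝ)) := by
  intro hcpt
  rw [← isCompact_iff_compactSpace] at hcpt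
  exact not_bddAbove_Ici (0 : ℝ) hcpt.bddAbove

theorem IsGraphWithEnds.isGraph {Y : Type*} [TopologicalSpace Y] {V : Set Y}
    (h : IsGraphWithEnds Y V) (hc : ∀ e ∈ edges V, IsCompact (closure e)) : IsGraph Y V where
  toIsOneDimComplex := h.toIsOneDimComplex
  closure_edge e he := by
    refine (h.closure_edge e he).resolve_right ?_
    rintro ⟨φ⟩
    have := isCompact_iff_compactSpace.1 (hc e he)
    exact not_compactSpace_Ici_zero φ.compactSpace

theorem image_mem_edges {Y Z : Type*} [TopologicalSpace Y] [TopologicalSpace Z] (φ : Y ≃ₜ Z)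
    {V e : Set Y} (he : e ∈ edges V) : φ '' e ∈ edges (φ '' V) := by
  obtain ⟨y, hy, rfl⟩ := he
  refine ⟨φ y, ?_, ?_⟩
  · rw [← image_compl_eq φ.bijective]
    exact mem_image_of_mem _ hy
  · rw [φ.image_connectedComponentIn hy, image_compl_eq φ.bijective]

theorem IsIsomorphicToGraph.isCompact_closure {Y : Type} [TopologicalSpace Y] {V e : Set Y}
    (h : IsIsomorphicToGraph Y V) (he : e ∈ edges V) : IsCompact (closure e) := by
  obtain ⟨Z, _, W, hW, φ, rfl⟩ := h
  have := hW.isCompact_closure (image_mem_edges φ he)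
  rw [← φ.image_closure] at this
  exact φ.isCompact_image.1 this

end LevelFunction

/-! ### Persistence of superlevel intervals in a one-parameter family of real functions. -/

section RealFunctions

/-- The left end of the component of `{φ ≥ 0}` that contains `x₀`. -/
theorem exists_left_end {φ : ℝ → ℝ} (hφ : Continuous φ) {a' x₀ : ℝ} (ha' : φ a' < 0)
    (hlt : a' < x₀) (hx₀ : 0 ≤ φ x₀) :
    ∃ a ∈ Ioc a' x₀, φ a = 0 ∧ (∀ x ∈ Icc a x₀, 0 ≤ φ x) ∧ ∃ᶠ x in 𝓝[<] a, φ x < 0 := by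
  -- The end is the last limit of negative values before `x₀`.
  set S := {x | x ∈ Icc a' x₀ ∧ φ x < 0} with hS
  have ha'S : a' ∈ S := ⟨⟨le_rfl, hlt.le⟩, ha'⟩
  have hbdd : BddAbove S := ⟨x₀, fun x hx => hx.1.2⟩
  set a := sSup S with ha
  have hax₀ : a ≤ x₀ := csSup_le ⟨a', ha'S⟩ fun x hx => hx.1.2
  have ha'a : a' ≤ a := le_csSup hbdd ha'S
  have hacl : a ∈ closure S := csSup_mem_closure ⟨a', ha'S⟩ hbdd
  have hright : ∀ x ∈ Icc a x₀, x ≠ a → 0 ≤ φ x := by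
    intro x hx hxa
    by_contra hneg
    exact hxa (le_antisymm (le_csSup hbdd ⟨⟨ha'a.trans hx.1, hx.2⟩, not_le.1 hneg⟩) hx.1)
  have hle : φ a ≤ 0 :=
    closure_minimal (fun x hx => hx.2.le) (isClosed_le hφ continuous_const) hacl
  have hge : 0 ≤ φ a := by
    rcases hax₀.eq_or_lt with heq | hlt'
    · rwa [heq]
    · have hmem : a ∈ closure (Ioc a x₀) := by
        rw [closure_Ioc hlt'.ne]
        exact left_mem_Icc.2 hax₀
      exact closure_minimal (fun x hx => hright x ⟨hx.1.le, hx.2⟩ hx.1.ne')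
        (isClosed_le continuous_const hφ) hmem
  have haS : a ∉ S := fun h => hge.not_gt h.2
  refine ⟨a, ⟨ha'a.lt_of_ne ?_, hax₀⟩, le_antisymm hle hge, fun x hx => ?_, ?_⟩
  · intro h
    rw [h] at ha'
    exact hge.not_gt ha'
  · by_cases hxa : x = a
    · rwa [hxa]
    · exact hright x hx hxa
  · rw [frequently_nhdsWithin_iff, frequently_iff]
    intro U hU
    obtain ⟨x, hxU, hxS⟩ := mem_closure_iff_nhds.1 hacl U hU
    refine ⟨x, hxU, hxS.2, (le_csSup hbdd hxS).lt_of_ne ?_⟩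
    rintro rfl
    exact haS hxS

theorem exists_right_end {φ : ℝ → ℝ} (hφ : Continuous φ) {b' x₀ : ℝ} (hb' : φ b' < 0)
    (hlt : x₀ < b') (hx₀ : 0 ≤ φ x₀) :
    ∃ b ∈ Ico x₀ b', φ b = 0 ∧ (∀ x ∈ Icc x₀ b, 0 ≤ φ x) ∧ ∃ᶠ x in 𝓝[>] b, φ x < 0 := by
  obtain ⟨a, ha, h0, hpos, hfreq⟩ := exists_left_end (φ := fun x => φ (-x)) (a' := -b')
    (x₀ := -x₀) (by fun_prop) (by simpa using hb') (by linarith) (by simpa using hx₀)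
  refine ⟨-a, ⟨by linarith [ha.2], by linarith [ha.1]⟩, h0, fun x hx => ?_, ?_⟩
  · have := hpos (-x) ⟨by linarith [hx.2], by linarith [hx.1]⟩
    simpa using this
  · have ht : Tendsto (fun x : ℝ => -x) (𝓝[<] a) (𝓝[>] (-a)) := tendsto_neg_nhdsLT
    exact ht.frequently hfreq

/-- Negative values just to the left of the zero give positive slopes there, arbitrarily close to
`a`. -/
theorem deriv_nonneg_of_frequently_neg {φ : ℝ → ℝ} {a d : ℝ} (hd : HasDerivAt φ d a)
    (h0 : φ a = 0) (hfreq : ∃ᶠ x in 𝓝[<] a, φ x < 0) : 0 ≤ d := by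
  by_contra hneg
  have hs := (hasDerivAt_iff_tendsto_slope_left_right.1 hd).1
  have hev := hs.eventually (gt_mem_nhds (not_le.1 hneg))
  obtain ⟨x, hx, hx', hxa⟩ := (hfreq.and_eventually (hev.and self_mem_nhdsWithin)).exists
  have hxa : x < a := hxa
  rw [slope_def_field, h0] at hx'
  have : 0 < (φ x - 0) / (x - a) := div_pos_of_neg_of_neg (by linarith) (by linarith)
  linarith

theorem deriv_nonpos_of_frequently_neg {φ : ℝ → ℝ} {b d : ℝ} (hd : HasDerivAt φ d b)
    (h0 : φ b = 0) (hfreq : ∃ᶠ x in 𝓝[>] b, φ x < 0) : d ≤ 0 := by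
  by_contra hneg
  have hs := (hasDerivAt_iff_tendsto_slope_left_right.1 hd).2
  have hev := hs.eventually (lt_mem_nhds (not_le.1 hneg))
  obtain ⟨x, hx, hx', hxa⟩ := (hfreq.and_eventually (hev.and self_mem_nhdsWithin)).exists
  have hxa : b < x := hxa
  rw [slope_def_field, h0] at hx'
  have : (φ x - 0) / (x - b) < 0 := div_neg_of_neg_of_pos (by linarith) (by linarith)
  linarith

/-- A positive partial derivative makes the nearby functions of the family increasing on a common
interval. -/
theorem exists_strictMonoOn {φ ψ : ℝ → ℝ → ℝ} (hd : ∀ s x, HasDerivAt (φ s) (ψ s x) x)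
    (hψ : Continuous fun p : ℝ × ℝ => ψ p.1 p.2) {t a : ℝ} (hpos : 0 < ψ t a) :
    ∃ r > 0, ∀ s, |s - t| < r → StrictMonoOn (φ s) (Icc (a - r) (a + r)) := by
  have hev : ∀ᶠ p : ℝ × ℝ in 𝓝 (t, a), 0 < ψ p.1 p.2 :=
    hψ.continuousAt.eventually (lt_mem_nhds hpos)
  obtain ⟨ε, hε, H⟩ := Metric.eventually_nhds_iff.1 hev
  refine ⟨ε / 2, by linarith, fun s hs => ?_⟩
  refine strictMonoOn_of_hasDerivWithinAt_pos (f' := ψ s) (convex_Icc _ _)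
    (fun x _ => (hd s x).continuousAt.continuousWithinAt)
    (fun x _ => (hd s x).hasDerivWithinAt) fun x hx => ?_
  rw [interior_Icc] at hx
  refine H (y := (s, x)) ?_
  rw [Prod.dist_eq, max_lt_iff, Real.dist_eq, Real.dist_eq]
  refine ⟨by linarith, ?_⟩
  rw [abs_lt]
  constructor <;> linarith [hx.1, hx.2]

/-- The component of `{φ t ≥ 0}` through `x₀` persists, as a single interval, for the parameters
close to `t`, if it is bounded and `φ t` has no degenerate zero on it. -/
theorem exists_product_box {φ ψ : ℝ → ℝ → ℝ} (hφ : Continuous fun p : ℝ × ℝ => φ p.1 p.2)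
    (hd : ∀ s x, HasDerivAt (φ s) (ψ s x) x) (hψ : Continuous fun p : ℝ × ℝ => ψ p.1 p.2)
    {t x₀ a' b' : ℝ} (ha' : φ t a' < 0) (hb' : φ t b' < 0) (hax : a' < x₀) (hxb : x₀ < b')
    (hx₀ : 0 ≤ φ t x₀)
    (hreg : ∀ x, (∀ w ∈ uIcc x₀ x, 0 ≤ φ t w) → φ t x = 0 → ψ t x ≠ 0) :
    ∃ a b x₁ δ, a < x₀ ∧ x₀ < b ∧ 0 < δ ∧ ∀ s, |s - t| < δ → φ s a < 0 ∧ φ s b < 0 ∧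
      x₁ ∈ Ioo a b ∧ 0 ≤ φ s x₁ ∧ ∀ x ∈ Icc a b, 0 ≤ φ s x → ∀ w ∈ uIcc x₁ x, 0 ≤ φ s w := by
  have hφs : ∀ s, Continuous (φ s) := fun s => hφ.comp (by fun_prop : Continuous fun x => (s, x))
  have hφx : ∀ x, Continuous (fun s => φ s x) := fun x =>
    hφ.comp (by fun_prop : Continuous fun s => (s, x))
  obtain ⟨a, ha, ha0, hapos, hafreq⟩ := exists_left_end (hφs t) ha' hax hx₀
  obtain ⟨b, hb, hb0, hbpos, hbfreq⟩ := exists_right_end (hφs t) hb' hxb hx₀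
  have hseg : ∀ x ∈ Icc a b, ∀ w ∈ uIcc x₀ x, 0 ≤ φ t w := by
    intro x hx w hw
    rcases le_total x₀ x with h | h
    · rw [uIcc_of_le h] at hw
      exact hbpos w ⟨hw.1, hw.2.trans hx.2⟩
    · rw [uIcc_of_ge h] at hw
      exact hapos w ⟨hx.1.trans hw.1, hw.2⟩
  have hab' : a ≤ b := ha.2.trans hb.1
  have hda : 0 < ψ t a := (deriv_nonneg_of_frequently_neg (hd t a) ha0 hafreq).lt_of_ne'
    (hreg a (hseg a ⟨le_rfl, hab'⟩) ha0)
  have hdb : ψ t b < 0 := (deriv_nonpos_of_frequently_neg (hd t b) hb0 hbfreq).lt_of_ne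
    (hreg b (hseg b ⟨hab', le_rfl⟩) hb0)
  have hab : a < b := hab'.lt_of_ne (by rintro rfl; linarith)
  have hmid : ∀ x ∈ Ioo a b, 0 < φ t x := by
    intro x hx
    have h0 := hseg x ⟨hx.1.le, hx.2.le⟩ x right_mem_uIcc
    -- An interior zero would be a local minimum, hence degenerate, which `hreg` excludes.
    refine h0.lt_of_ne' fun hz => hreg x (hseg x ⟨hx.1.le, hx.2.le⟩) hz ?_
    refine IsLocalMin.hasDerivAt_eq_zero (f := φ t) (a := x) ?_ (hd t x)
    filter_upwards [Ioo_mem_nhds hx.1 hx.2] with w hw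
    rw [hz]
    exact hseg w ⟨hw.1.le, hw.2.le⟩ w right_mem_uIcc
  obtain ⟨r₁, hr₁, H₁⟩ := exists_strictMonoOn hd hψ hda
  obtain ⟨r₂, hr₂, H₂⟩ := exists_strictMonoOn (φ := fun s x => -φ s x) (ψ := fun s x => -ψ s x)
    (t := t) (a := b) (fun s x => (hd s x).neg) hψ.neg (by linarith)
  obtain ⟨r, hr, hr1, hr2, hr3⟩ : ∃ r > 0, r ≤ r₁ ∧ r ≤ r₂ ∧ r < (b - a) / 2 :=
    ⟨min (min r₁ r₂) ((b - a) / 4), by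
      have : 0 < (b - a) / 4 := by linarith
      positivity, (min_le_left _ _).trans (min_le_left _ _),
      (min_le_left _ _).trans (min_le_right _ _), (min_le_right _ _).trans_lt (by linarith)⟩
  have hneg_a : φ t (a - r) < 0 := by
    rw [← ha0]
    exact H₁ t (by simpa using hr₁) ⟨by linarith, by linarith⟩ ⟨by linarith, by linarith⟩
      (by linarith)
  have hneg_b : φ t (b + r) < 0 := by
    have := H₂ t (by simpa using hr₂) (a := b) (b := b + r) ⟨by linarith, by linarith⟩
      ⟨by linarith, by linarith⟩ (by linarith)
    simp only [hb0] at this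
    linarith
  have hmid' : ∀ᶠ s in 𝓝 t, ∀ x ∈ Icc (a + r) (b - r), 0 < φ s x := by
    refine isCompact_Icc.eventually_forall_of_forall_eventually fun x hx => ?_
    exact (hφ.continuousAt (x := (t, x))).eventually
      (lt_mem_nhds (hmid x ⟨by linarith [hx.1], by linarith [hx.2]⟩))
  have hev : ∀ᶠ s in 𝓝 t, φ s (a - r) < 0 ∧ φ s (b + r) < 0 ∧
      ∀ x ∈ Icc (a + r) (b - r), 0 < φ s x :=
    ((hφx _).continuousAt.eventually (gt_mem_nhds hneg_a)).and
      (((hφx _).continuousAt.eventually (gt_mem_nhds hneg_b)).and hmid')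
  obtain ⟨ε, hε, H⟩ := Metric.eventually_nhds_iff.1 hev
  -- For `s` near `t`, `φ s` increases on `[a - r, a + r]`, is positive on `[a + r, b - r]` and
  -- decreases on `[b - r, b + r]`. Its non-negative set in the box is thus one interval through `x₁
  -- = a + r`.
  refine ⟨a - r, b + r, a + r, min ε r, by linarith [ha.2], by linarith [hb.1], by positivity, ?_⟩
  intro s hs
  obtain ⟨h1, h2, h3⟩ := H (y := s) (by rw [Real.dist_eq]; exact hs.trans_le (min_le_left _ _))
  have hsr : |s - t| < r := hs.trans_le (min_le_right _ _)
  refine ⟨h1, h2, ⟨by linarith, by linarith⟩, (h3 _ ⟨le_rfl, by linarith⟩).le,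
    fun x hx hx0 w hw => ?_⟩
  have hmono := (H₁ s (hsr.trans_le hr1)).monotoneOn
  have hanti := (H₂ s (hsr.trans_le hr2)).monotoneOn
  rcases le_total (a + r) x with h | h
  · rw [uIcc_of_le h] at hw
    rcases le_total w (b - r) with hwb | hwb
    · exact (h3 w ⟨hw.1, hwb⟩).le
    · have := hanti (a := w) (b := x) ⟨by linarith, by linarith [hw.2, hx.2]⟩
        ⟨by linarith [hw.2], by linarith [hx.2]⟩ hw.2
      simp only [neg_le_neg_iff] at this
      linarith
  · rw [uIcc_of_ge h] at hw
    have := hmono (a := x) (b := w) ⟨by linarith [hx.1], by linarith⟩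
      ⟨by linarith [hx.1, hw.1], by linarith [hw.2]⟩ hw.1
    linarith

end RealFunctions

/-! ### The quotient of the strip by slice components, and its level function. -/

section StripQuotients

variable {c₁ c₂ : ℝ → ℝ}

/-- The set of all `x` such that `(s, x)` lies between the graphs of `c₁` and `c₂`. -/
def slice (c₁ c₂ : ℝ → ℝ) (s : ℝ) : Set ℝ :=
  {x | c₁ x ≤ s ∧ s ≤ c₂ x}

/-- The closed region between the graphs of `c₁` and `c₂`. -/
def strip (c₁ c₂ : ℝ → ℝ) : Set (ℝ × ℝ) :=
  {p | p.2 ∈ slice c₁ c₂ p.1}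

/-- The function `(s - c₁) (c₂ - s)`, whose non-negativity defines the strip. -/
def stripFn (c₁ c₂ : ℝ → ℝ) (s x : ℝ) : ℝ :=
  (s - c₁ x) * (c₂ x - s)

/-- The line at level `s` is tangent to one of the boundary curves over `x`. -/
def IsTangency (c₁ c₂ : ℝ → ℝ) (s x : ℝ) : Prop :=
  (c₁ x = s ∧ deriv c₁ x = 0) ∨ (c₂ x = s ∧ deriv c₂ x = 0)

theorem stripFn_nonneg_iff (hlt : ∀ x, c₁ x < c₂ x) {s x : ℝ} :
    0 ≤ stripFn c₁ c₂ s x ↔ x ∈ slice c₁ c₂ s := by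
  have := hlt x
  constructor
  · intro h
    rw [stripFn, mul_nonneg_iff] at h
    rcases h with h | h
    · exact ⟨by linarith [h.1], by linarith [h.2]⟩
    · linarith [h.1, h.2]
  · rintro ⟨h1, h2⟩
    exact mul_nonneg (by linarith) (by linarith)

theorem stripFn_neg_iff (hlt : ∀ x, c₁ x < c₂ x) {s x : ℝ} :
    stripFn c₁ c₂ s x < 0 ↔ x ∉ slice c₁ c₂ s := by
  rw [← stripFn_nonneg_iff hlt, not_le]

theorem continuous_stripFn (h₁ : Continuous c₁) (h₂ : Continuous c₂) :
    Continuous fun p : ℝ × ℝ => stripFn c₁ c₂ p.1 p.2 := by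
  unfold stripFn
  fun_prop

theorem isClosed_strip (h₁ : Continuous c₁) (h₂ : Continuous c₂) : IsClosed (strip c₁ c₂) :=
  (isClosed_le (h₁.comp continuous_snd) continuous_fst).inter
    (isClosed_le continuous_fst (h₂.comp continuous_snd))

/-- The derivative of `stripFn` in the second variable. -/
noncomputable def stripDeriv (c₁ c₂ : ℝ → ℝ) (s x : ℝ) : ℝ :=
  -deriv c₁ x * (c₂ x - s) + (s - c₁ x) * deriv c₂ x

theorem hasDerivAt_stripFn (h₁ : Differentiable ℝ c₁) (h₂ : Differentiable ℝ c₂) (s x : ℝ) :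
    HasDerivAt (stripFn c₁ c₂ s) (stripDeriv c₁ c₂ s x) x :=
  ((h₁ x).hasDerivAt.const_sub s).mul ((h₂ x).hasDerivAt.sub_const s)

/-- Since `c₁ x < c₂ x`, exactly one factor of `stripFn` vanishes at a zero, and the derivative is
then a non-zero multiple of the slope of the corresponding curve. So tangencies are the degenerate
zeros. -/
theorem isTangency_iff (hlt : ∀ x, c₁ x < c₂ x) {s x : ℝ} :
    IsTangency c₁ c₂ s x ↔ stripFn c₁ c₂ s x = 0 ∧ stripDeriv c₁ c₂ s x = 0 := by
  have := hlt x
  constructor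
  · rintro (⟨rfl, h⟩ | ⟨rfl, h⟩) <;> simp [stripFn, stripDeriv, h]
  · rintro ⟨h0, hd⟩
    rcases mul_eq_zero.1 h0 with h | h
    · obtain rfl : c₁ x = s := by linarith
      left
      simp only [stripDeriv, sub_self, zero_mul, add_zero, mul_eq_zero, neg_eq_zero] at hd
      exact ⟨rfl, hd.resolve_right (by linarith)⟩
    · obtain rfl : c₂ x = s := by linarith
      right
      simp only [stripDeriv, sub_self, mul_zero, zero_add, mul_eq_zero] at hd
      exact ⟨rfl, hd.resolve_left (by linarith)⟩

theorem IsTangency.mem_slice (hlt : ∀ x, c₁ x < c₂ x) {s x : ℝ} (h : IsTangency c₁ c₂ s x) :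
    x ∈ slice c₁ c₂ s := by
  rcases h with ⟨rfl, -⟩ | ⟨rfl, -⟩
  · exact ⟨le_rfl, (hlt x).le⟩
  · exact ⟨(hlt x).le, le_rfl⟩

/-- Every component of a slice is isolated in its slice and lies in a box without tangencies at
other levels. -/
def HasBoxes (c₁ c₂ : ℝ → ℝ) : Prop :=
  ∀ t, ∀ x₀ ∈ slice c₁ c₂ t, ∃ a b δ, a < x₀ ∧ x₀ < b ∧ 0 < δ ∧
    (∀ s, |s - t| ≤ δ → a ∉ slice c₁ c₂ s ∧ b ∉ slice c₁ c₂ s) ∧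
    (∀ x ∈ Icc a b, x ∈ slice c₁ c₂ t → uIcc x₀ x ⊆ slice c₁ c₂ t) ∧
    ∀ s x, |s - t| ≤ δ → x ∈ Icc a b → IsTangency c₁ c₂ s x → s = t

/-- The map `ρ` is a quotient map of the strip onto the space of the components of all slices, and
`f` is the level function of this space. -/
structure IsSliceQuotient {Y : Type*} [TopologicalSpace Y] (ρ : strip c₁ c₂ → Y) (f : Y → ℝ) :
    Prop where
  isQuotientMap : IsQuotientMap ρ
  level : ∀ p, f (ρ p) = p.1.1
  eq_iff : ∀ p q, ρ p = ρ q ↔ p.1.1 = q.1.1 ∧ uIcc p.1.2 q.1.2 ⊆ slice c₁ c₂ p.1.1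

theorem mem_Ioo_of_uIcc_subset {S : Set ℝ} {a b x y : ℝ} (ha : a ∉ S) (hb : b ∉ S)
    (hxy : uIcc x y ⊆ S) (hx : x ∈ Icc a b) : y ∈ Ioo a b := by
  constructor
  · by_contra h
    exact ha (hxy (mem_uIcc.2 (Or.inr ⟨not_lt.1 h, hx.1⟩)))
  · by_contra h
    exact hb (hxy (mem_uIcc.2 (Or.inl ⟨hx.2, not_lt.1 h⟩)))

/-- Interpolating linearly between the two curves parametrises this set by `Q ×ˢ Icc 0 1`. -/
theorem isPreconnected_strip_over (h₁ : Continuous c₁) (h₂ : Continuous c₂)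
    (hlt : ∀ x, c₁ x < c₂ x) {Q : Set ℝ} (hQ : IsPreconnected Q) :
    IsPreconnected {p : strip c₁ c₂ | p.1.2 ∈ Q} := by
  rw [← IsInducing.subtypeVal.isPreconnected_image]
  have himg : Subtype.val '' {p : strip c₁ c₂ | p.1.2 ∈ Q} =
      (fun q : ℝ × ℝ => (c₁ q.1 + q.2 * (c₂ q.1 - c₁ q.1), q.1)) '' (Q ×ˢ Icc 0 1) := by
    ext ⟨s, x⟩
    have hx := hlt x
    constructor
    · rintro ⟨⟨_, h1, h2⟩, hxQ, rfl⟩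
      have h1 : c₁ x ≤ s := h1
      have h2 : s ≤ c₂ x := h2
      refine ⟨(x, (s - c₁ x) / (c₂ x - c₁ x)), ⟨hxQ, ?_, ?_⟩, ?_⟩
      · exact div_nonneg (by linarith) (by linarith)
      · exact (div_le_one (by linarith)).2 (by linarith)
      · simp only [Prod.mk.injEq, and_true]
        rw [div_mul_cancel₀ _ (by linarith)]
        ring
    · rintro ⟨⟨x', u⟩, ⟨hxQ, hu0, hu1⟩, heq⟩
      simp only [Prod.mk.injEq] at heq hu0 hu1
      obtain ⟨rfl, rfl⟩ := heq
      refine ⟨⟨(_, x'), ?_, ?_⟩, hxQ, rfl⟩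
      · simp only
        nlinarith
      · simp only
        nlinarith
  rw [himg]
  exact (hQ.prod isPreconnected_Icc).image _ (by fun_prop)

namespace IsSliceQuotient

variable {Y : Type*} [TopologicalSpace Y] {ρ : strip c₁ c₂ → Y} {f : Y → ℝ}

theorem continuous (h : IsSliceQuotient ρ f) : Continuous f := by
  rw [h.isQuotientMap.continuous_iff]
  have : f ∘ ρ = fun p => p.1.1 := funext h.level
  rw [this]
  fun_prop

theorem isOpen_image_of_saturated (h : IsSliceQuotient ρ f) {O : Set (strip c₁ c₂)}
    (hO : IsOpen O)
    (hsat : ∀ p ∈ O, ∀ q, p.1.1 = q.1.1 → uIcc p.1.2 q.1.2 ⊆ slice c₁ c₂ p.1.1 → q ∈ O) :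
    IsOpen (ρ '' O) := by
  rw [← h.isQuotientMap.isOpen_preimage]
  convert hO using 1
  refine Subset.antisymm ?_ (subset_preimage_image _ _)
  rintro q ⟨p, hp, hpq⟩
  obtain ⟨h1, h2⟩ := (h.eq_iff p q).1 hpq
  exact hsat p hp q h1 h2

/-- Different levels are separated by `f`. Two components of the same slice have a gap point `z`
between them; it stays outside the nearby slices, so the points left of `z` and those right of `z`
at such levels form disjoint saturated open sets. -/
theorem t2Space (h : IsSliceQuotient ρ f) (h₁ : Continuous c₁) (h₂ : Continuous c₂)
    (hlt : ∀ x, c₁ x < c₂ x) : T2Space Y := by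
  refine ⟨fun y y' hyy' => ?_⟩
  obtain ⟨p, rfl⟩ := h.isQuotientMap.surjective y
  obtain ⟨q, rfl⟩ := h.isQuotientMap.surjective y'
  by_cases hlev : p.1.1 = q.1.1
  swap
  · exact separated_by_continuous h.continuous (by rwa [h.level, h.level])
  wlog hpq : p.1.2 ≤ q.1.2 generalizing p q
  · obtain ⟨u, v, hu, hv, hqu, hpv, huv⟩ := this q p hyy'.symm hlev.symm (le_of_not_ge hpq)
    exact ⟨v, u, hv, hu, hpv, hqu, huv.symm⟩
  have hex : ∃ z ∈ Icc p.1.2 q.1.2, z ∉ slice c₁ c₂ p.1.1 := by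
    by_contra! hcon
    refine hyy' ((h.eq_iff p q).2 ⟨hlev, ?_⟩)
    rw [uIcc_of_le hpq]
    exact hcon
  obtain ⟨z, hz, hzs⟩ := hex
  have hopen : IsOpen {r : strip c₁ c₂ | z ∉ slice c₁ c₂ r.1.1} := by
    simp only [← stripFn_neg_iff hlt]
    have := continuous_stripFn h₁ h₂
    exact isOpen_lt (this.comp (by fun_prop : Continuous fun r : strip c₁ c₂ => (r.1.1, z)))
      continuous_const
  have hsnd : Continuous fun r : strip c₁ c₂ => r.1.2 := by fun_prop
  refine ⟨ρ '' {r | r.1.2 < z ∧ z ∉ slice c₁ c₂ r.1.1},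
    ρ '' {r | z < r.1.2 ∧ z ∉ slice c₁ c₂ r.1.1}, ?_, ?_, ⟨p, ⟨?_, hzs⟩, rfl⟩,
    ⟨q, ⟨?_, hlev ▸ hzs⟩, rfl⟩, ?_⟩
  · refine h.isOpen_image_of_saturated
      ((isOpen_lt hsnd continuous_const).inter hopen) ?_
    rintro r ⟨hr, hrz⟩ r' hl hs
    refine ⟨?_, show z ∉ slice c₁ c₂ r'.1.1 from hl ▸ hrz⟩
    by_contra hcon
    exact hrz (hs (mem_uIcc.2 (Or.inl ⟨hr.le, not_lt.1 hcon⟩)))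
  · refine h.isOpen_image_of_saturated
      ((isOpen_lt continuous_const hsnd).inter hopen) ?_
    rintro r ⟨hr, hrz⟩ r' hl hs
    refine ⟨?_, show z ∉ slice c₁ c₂ r'.1.1 from hl ▸ hrz⟩
    by_contra hcon
    exact hrz (hs (mem_uIcc.2 (Or.inr ⟨not_lt.1 hcon, hr.le⟩)))
  · refine hz.1.lt_of_ne ?_
    rintro rfl
    exact hzs p.2
  · refine hz.2.lt_of_ne ?_
    rintro rfl
    exact hzs (hlev ▸ q.2)
  · rw [disjoint_left]
    rintro _ ⟨r, ⟨hr, hrz⟩, rfl⟩ ⟨r', ⟨hr', -⟩, heq⟩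
    obtain ⟨hl, hs⟩ := (h.eq_iff r' r).1 heq
    exact hrz (hl ▸ hs (mem_uIcc.2 (Or.inr ⟨hr.le, hr'.le⟩)))

/-- The box is saturated: a component of a slice that meets it cannot cross the sides over `a` and
`b`. -/
theorem isOpen_image_box (h : IsSliceQuotient ρ f) {a b u v : ℝ}
    (hab : ∀ s ∈ Ioo u v, a ∉ slice c₁ c₂ s ∧ b ∉ slice c₁ c₂ s) :
    IsOpen (ρ '' {p | p.1.2 ∈ Ioo a b ∧ p.1.1 ∈ Ioo u v}) := by
  refine h.isOpen_image_of_saturated ((isOpen_Ioo.preimage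
    (by fun_prop : Continuous fun p : strip c₁ c₂ => p.1.2)).inter (isOpen_Ioo.preimage
    (by fun_prop : Continuous fun p : strip c₁ c₂ => p.1.1))) ?_
  rintro p ⟨hp, hp'⟩ q hl hs
  exact ⟨mem_Ioo_of_uIcc_subset (hab _ hp').1 (hab _ hp').2 hs (Ioo_subset_Icc_self hp),
    show q.1.1 ∈ Ioo u v from hl ▸ hp'⟩

theorem isCompact_box (h₁ : Continuous c₁) (h₂ : Continuous c₂) (a b u v : ℝ) :
    IsCompact {p : strip c₁ c₂ | p.1.2 ∈ Icc a b ∧ p.1.1 ∈ Icc u v} := by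
  have := (isClosed_strip h₁ h₂).isClosedEmbedding_subtypeVal.isCompact_preimage
    ((isCompact_Icc (a := u) (b := v)).prod (isCompact_Icc (a := a) (b := b)))
  convert this using 1
  ext p
  exact and_comm

/-- The images of small boxes are compact neighbourhoods, open relative to the nearby levels. -/
theorem exists_compact_box (h : IsSliceQuotient ρ f) (h₁ : Continuous c₁) (h₂ : Continuous c₂)
    (hbox : HasBoxes c₁ c₂) (y : Y) (O : Set Y) (hO : O ∈ 𝓝 y) :
    ∃ C : Set Y, ∃ δ > 0, IsCompact C ∧ y ∈ C ∧ C ⊆ O ∧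
      C ∩ ρ '' {p | IsTangency c₁ c₂ p.1.1 p.1.2} ⊆ {y} ∧ C ∩ f ⁻¹' {f y} ⊆ {y} ∧
      IsOpen (C ∩ f ⁻¹' Ioo (f y - δ) (f y + δ)) := by
  obtain ⟨⟨⟨t, x₀⟩, hx₀⟩, rfl⟩ := h.isQuotientMap.surjective y
  have hx₀' : x₀ ∈ slice c₁ c₂ t := hx₀
  obtain ⟨a, b, δ, hax, hxb, hδ, hends, hcomp, htan⟩ := hbox t x₀ hx₀'
  obtain ⟨O', hO'O, hO', hyO'⟩ := mem_nhds_iff.1 hO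
  have hlevt : ∀ p : strip c₁ c₂, p.1.2 ∈ Icc a b → p.1.1 = t → ρ p = ρ ⟨(t, x₀), hx₀⟩ := by
    rintro ⟨⟨s, x⟩, hx⟩ hxab hst
    obtain rfl : s = t := hst
    exact ((h.eq_iff ⟨(s, x₀), hx₀⟩ ⟨(s, x), hx⟩).2 ⟨rfl, hcomp x hxab hx⟩).symm
  -- These are the levels at which the compact box leaves `O'`. They form a closed set without `t`,
  -- so a box of smaller height `η` maps into `O'`.
  have hcl : IsClosed ((fun p : strip c₁ c₂ => p.1.1) ''
      ({p | p.1.2 ∈ Icc a b ∧ p.1.1 ∈ Icc (t - δ) (t + δ)} ∩ (ρ ⁻¹' O')ᶜ)) :=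
    (((isCompact_box h₁ h₂ a b (t - δ) (t + δ)).inter_right
      (hO'.preimage h.isQuotientMap.continuous).isClosed_compl).image (by fun_prop)).isClosed
  have htnot : t ∉ (fun p : strip c₁ c₂ => p.1.1) ''
      ({p | p.1.2 ∈ Icc a b ∧ p.1.1 ∈ Icc (t - δ) (t + δ)} ∩ (ρ ⁻¹' O')ᶜ) := by
    rintro ⟨p, ⟨⟨hp, -⟩, hpO⟩, hpt⟩
    exact hpO (show ρ p ∈ O' by rwa [hlevt p hp hpt])
  obtain ⟨ε, hε, hball⟩ := Metric.isOpen_iff.1 hcl.isOpen_compl t htnot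
  obtain ⟨η, hη, hηδ, hηε⟩ : ∃ η > 0, η ≤ δ ∧ η < ε :=
    ⟨min δ (ε / 2), by positivity, min_le_left _ _, (min_le_right _ _).trans_lt (by linarith)⟩
  have habs : ∀ s, s ∈ Icc (t - η) (t + η) → |s - t| ≤ η := by
    intro s hs
    rw [abs_le]
    constructor <;> linarith [hs.1, hs.2]
  refine ⟨ρ '' {p | p.1.2 ∈ Icc a b ∧ p.1.1 ∈ Icc (t - η) (t + η)}, η, hη,
    (isCompact_box h₁ h₂ a b _ _).image h.isQuotientMap.continuous,
    ⟨_, ⟨⟨hax.le, hxb.le⟩, by simp [hη.le]⟩, rfl⟩, ?_, ?_, ?_, ?_⟩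
  · rintro _ ⟨p, ⟨hp, hp'⟩, rfl⟩
    apply hO'O
    by_contra hpO
    refine hball (a := p.1.1) ?_ ⟨p, ⟨⟨hp, ?_⟩, hpO⟩, rfl⟩
    · rw [Metric.mem_ball, Real.dist_eq]
      exact (habs _ hp').trans_lt hηε
    · exact ⟨by linarith [hp'.1], by linarith [hp'.2]⟩
  · rintro _ ⟨⟨p, ⟨hp, hp'⟩, rfl⟩, ⟨q, hq, hqp⟩⟩
    obtain ⟨hl, hs⟩ := (h.eq_iff p q).1 hqp.symm
    have habs' := (habs _ hp').trans hηδ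
    have hqm := mem_Ioo_of_uIcc_subset (hends _ habs').1 (hends _ habs').2 hs hp
    have hqt : q.1.1 = t := htan q.1.1 q.1.2 (hl ▸ habs') (Ioo_subset_Icc_self hqm) hq
    exact hlevt p hp (hl.trans hqt)
  · rintro _ ⟨⟨p, ⟨hp, hp'⟩, rfl⟩, hf⟩
    rw [mem_preimage, h.level, h.level] at hf
    exact hlevt p hp hf
  · have hopen := h.isOpen_image_box (a := a) (b := b) (u := t - η) (v := t + η) fun s hs =>
      hends s ((habs s (Ioo_subset_Icc_self hs)).trans hηδ)
    convert hopen using 1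
    rw [h.level]
    ext y
    constructor
    · rintro ⟨⟨p, ⟨hp, hp'⟩, rfl⟩, hf⟩
      rw [mem_preimage, h.level] at hf
      have habs' := (habs _ hp').trans hηδ
      exact ⟨p, ⟨mem_Ioo_of_uIcc_subset (hends _ habs').1 (hends _ habs').2
        (by simpa using show p.1.2 ∈ slice c₁ c₂ p.1.1 from p.2) hp, hf⟩, rfl⟩
    · rintro ⟨p, ⟨hp, hp'⟩, rfl⟩
      refine ⟨⟨p, ⟨Ioo_subset_Icc_self hp, Ioo_subset_Icc_self hp'⟩, rfl⟩, ?_⟩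
      rwa [mem_preimage, h.level]

/-- Near a component without tangencies, the level function is a local homeomorphism. -/
theorem exists_section (h : IsSliceQuotient ρ f) (h₁ : ContDiff ℝ ∞ c₁) (h₂ : ContDiff ℝ ∞ c₂)
    (hlt : ∀ x, c₁ x < c₂ x) (hbox : HasBoxes c₁ c₂) {y : Y}
    (hy : y ∉ ρ '' {p | IsTangency c₁ c₂ p.1.1 p.1.2}) :
    ∃ g : ℝ → Y, ∃ δ > 0, ContinuousOn g (Ioo (f y - δ) (f y + δ)) ∧ g (f y) = y ∧
      (∀ s ∈ Ioo (f y - δ) (f y + δ), f (g s) = s) ∧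
      ∀ η ≤ δ, IsOpen (g '' Ioo (f y - η) (f y + η)) := by
  obtain ⟨⟨⟨t, x₀⟩, hx₀⟩, rfl⟩ := h.isQuotientMap.surjective y
  have hx₀' : x₀ ∈ slice c₁ c₂ t := hx₀
  obtain ⟨a', b', δ', hax, hxb, hδ', hends, -, -⟩ := hbox t x₀ hx₀'
  have hψ : Continuous fun p : ℝ × ℝ => stripDeriv c₁ c₂ p.1 p.2 := by
    have d₁ := h₁.continuous_deriv (by simp)
    have d₂ := h₂.continuous_deriv (by simp)
    have e₁ := h₁.continuous
    have e₂ := h₂.continuous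
    unfold stripDeriv
    fun_prop
  obtain ⟨a, b, x₁, δ, ha, hb, hδ, H⟩ := exists_product_box
    (continuous_stripFn h₁.continuous h₂.continuous)
    (hasDerivAt_stripFn (h₁.differentiable (by simp)) (h₂.differentiable (by simp))) hψ
    ((stripFn_neg_iff hlt).2 (hends t (by simpa using hδ'.le)).1)
    ((stripFn_neg_iff hlt).2 (hends t (by simpa using hδ'.le)).2) hax hxb
    ((stripFn_nonneg_iff hlt).2 hx₀') (by
      intro x hx h0 hd0
      have hx : uIcc x₀ x ⊆ slice c₁ c₂ t := fun w hw => (stripFn_nonneg_iff hlt).1 (hx w hw)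
      have htan : IsTangency c₁ c₂ t x := (isTangency_iff hlt).2 ⟨h0, hd0⟩
      refine hy ⟨⟨(t, x), htan.mem_slice hlt⟩, htan, ?_⟩
      exact ((h.eq_iff ⟨(t, x₀), hx₀⟩ ⟨(t, x), _⟩).2 ⟨rfl, hx⟩).symm)
  simp only [stripFn_neg_iff hlt, stripFn_nonneg_iff hlt] at H
  have hlevel : f (ρ ⟨(t, x₀), hx₀⟩) = t := h.level _
  rw [hlevel]
  have habs : ∀ s ∈ Ioo (t - δ) (t + δ), |s - t| < δ := by
    intro s hs
    rw [abs_lt]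
    constructor <;> linarith [hs.1, hs.2]
  classical
  -- The single abscissa `x₁` lies in all slices near level `t` and represents the component in the
  -- box. The value in the other case plays no role.
  set g : ℝ → Y := fun s => if hs : x₁ ∈ slice c₁ c₂ s then ρ ⟨(s, x₁), hs⟩ else
    ρ ⟨(t, x₀), hx₀⟩ with hg
  have hmem : ∀ s ∈ Ioo (t - δ) (t + δ), (s, x₁) ∈ strip c₁ c₂ := fun s hs =>
    (H s (habs s hs)).2.2.2.1
  have hgs : ∀ s (hs : s ∈ Ioo (t - δ) (t + δ)), g s = ρ ⟨(s, x₁), hmem s hs⟩ :=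
    fun s hs => dif_pos (hmem s hs)
  have hgρ : ∀ p : strip c₁ c₂, p.1.2 ∈ Icc a b → p.1.1 ∈ Ioo (t - δ) (t + δ) →
      g p.1.1 = ρ p := by
    intro p hp hp'
    rw [hgs _ hp']
    exact (h.eq_iff _ _).2 ⟨rfl, (H _ (habs _ hp')).2.2.2.2 _ hp p.2⟩
  refine ⟨g, δ, hδ, ?_, ?_, ?_, fun η hη => ?_⟩
  · rw [continuousOn_iff_continuous_domRestrict]
    have : (Ioo (t - δ) (t + δ)).domRestrict g =
        fun s => ρ ⟨(s.1, x₁), hmem s.1 s.2⟩ := funext fun s => hgs s.1 s.2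
    rw [this]
    exact h.isQuotientMap.continuous.comp (Continuous.subtype_mk (by fun_prop) _)
  · exact hgρ ⟨(t, x₀), hx₀⟩ ⟨ha.le, hb.le⟩ ⟨by simpa using hδ, by simpa using hδ⟩
  · intro s hs
    rw [hgs s hs, h.level]
  · have hsub : Ioo (t - η) (t + η) ⊆ Ioo (t - δ) (t + δ) :=
      Ioo_subset_Ioo (by linarith) (by linarith)
    have hopen := h.isOpen_image_box (a := a) (b := b) (u := t - η) (v := t + η) fun s hs =>
      ⟨(H s (habs s (hsub hs))).1, (H s (habs s (hsub hs))).2.1⟩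
    convert hopen using 1
    ext y
    constructor
    · rintro ⟨s, hs, rfl⟩
      rw [hgs s (hsub hs)]
      exact ⟨_, ⟨(H s (habs s (hsub hs))).2.2.1, hs⟩, rfl⟩
    · rintro ⟨p, ⟨hp, hp'⟩, rfl⟩
      exact ⟨p.1.1, hp', hgρ p (Ioo_subset_Icc_self hp) (hsub hp')⟩

/-- Off the vertices, the local sections of `exists_section` give openness and local injectivity of
`f`; the compact boxes give the rest. -/
theorem isLevelFunction (h : IsSliceQuotient ρ f) (h₁ : ContDiff ℝ ∞ c₁) (h₂ : ContDiff ℝ ∞ c₂)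
    (hlt : ∀ x, c₁ x < c₂ x) (hbox : HasBoxes c₁ c₂) :
    IsLevelFunction f (ρ '' {p | IsTangency c₁ c₂ p.1.1 p.1.2}) := by
  set V := ρ '' {p | IsTangency c₁ c₂ p.1.1 p.1.2} with hV
  have hboxes := h.exists_compact_box h₁.continuous h₂.continuous hbox
  have hVo : IsOpen Vᶜ := by
    rw [isOpen_iff_mem_nhds]
    intro y hy
    obtain ⟨C, δ, hδ, -, hyC, -, hCV, -, ho⟩ := hboxes y univ univ_mem
    filter_upwards [ho.mem_nhds ⟨hyC, by simp [hδ]⟩] with z hz hzV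
    obtain rfl : z = y := hCV ⟨hz.1, hzV⟩
    exact hy hzV
  refine ⟨h.continuous, fun O hO hOV => ?_, fun y hy => ?_, hboxes⟩
  · rw [isOpen_iff_mem_nhds]
    rintro _ ⟨y, hy, rfl⟩
    obtain ⟨g, δ, hδ, hgc, hgy, hfg, -⟩ := h.exists_section h₁ h₂ hlt hbox (hOV hy)
    have hI : Ioo (f y - δ) (f y + δ) ∈ 𝓝 (f y) := Ioo_mem_nhds (by linarith) (by linarith)
    filter_upwards [hI, (hgc.continuousAt hI).preimage_mem_nhds
      (hO.mem_nhds (hgy.symm ▸ hy))] with s hs hsO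
    exact ⟨g s, hsO, hfg s hs⟩
  · obtain ⟨g, δ, hδ, hgc, hgy, hfg, hgo⟩ := h.exists_section h₁ h₂ hlt hbox hy
    have hI : Ioo (f y - δ) (f y + δ) ∈ 𝓝 (f y) := Ioo_mem_nhds (by linarith) (by linarith)
    obtain ⟨ε, hε, hball⟩ := Metric.mem_nhds_iff.1 ((hgc.continuousAt hI).preimage_mem_nhds
      (hVo.mem_nhds (hgy.symm ▸ hy)))
    have hsub : Ioo (f y - min δ ε) (f y + min δ ε) ⊆ Ioo (f y - δ) (f y + δ) :=
      Ioo_subset_Ioo (by linarith [min_le_left δ ε]) (by linarith [min_le_left δ ε])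
    have hpos : 0 < min δ ε := lt_min hδ hε
    refine ⟨g '' Ioo (f y - min δ ε) (f y + min δ ε), hgo _ (min_le_left _ _),
      ⟨f y, by simp [hδ, hε], hgy⟩, ?_, isPreconnected_Ioo.image g (hgc.mono hsub), ?_⟩
    · rintro _ ⟨s, hs, rfl⟩
      refine hball ?_
      rw [Real.ball_eq_Ioo]
      exact ⟨by linarith [hs.1, min_le_right δ ε], by linarith [hs.2, min_le_right δ ε]⟩
    · rintro _ ⟨s, hs, rfl⟩ _ ⟨s', hs', rfl⟩ heq
      rw [hfg s (hsub hs), hfg s' (hsub hs')] at heq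
      rw [heq]

end IsSliceQuotient

end StripQuotients

/-! ### Non-compact closed edges and the ends of the strip. -/

section Ends

variable {c₁ c₂ : ℝ → ℝ}

namespace IsSliceQuotient

variable {Y : Type*} [TopologicalSpace Y] {ρ : strip c₁ c₂ → Y} {f : Y → ℝ}

theorem connectedSpace (h : IsSliceQuotient ρ f) (h₁ : Continuous c₁) (h₂ : Continuous c₂)
    (hlt : ∀ x, c₁ x < c₂ x) : ConnectedSpace Y := by
  have hpre := isPreconnected_strip_over h₁ h₂ hlt isPreconnected_univ
  have hr : range ρ = univ := h.isQuotientMap.surjective.range_eq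
  rw [connectedSpace_iff_univ]
  refine ⟨⟨ρ ⟨(c₁ 0, 0), le_rfl, (hlt 0).le⟩, mem_univ _⟩, ?_⟩
  rw [← hr, ← image_univ]
  exact IsPreconnected.image (by simpa using hpre) _ h.isQuotientMap.continuous.continuousOn

/-- A curve in the strip that runs to infinity through components without tangencies lies in an
edge whose closure is not compact. -/
theorem exists_not_isCompact_closure (h : IsSliceQuotient ρ f) (hbox : HasBoxes c₁ c₂)
    {κ : ℝ → ℝ} (hκ : Continuous κ) (hmem : ∀ x, x ∈ slice c₁ c₂ (κ x)) {l : Filter ℝ} [l.NeBot]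
    (hl : ∀ a b, ∀ᶠ x in l, x ∉ Icc a b) {Q : Set ℝ} (hQl : Q ∈ l) (hQ : IsPreconnected Q)
    (htan : ∀ x ∈ Q, ∀ z, uIcc x z ⊆ slice c₁ c₂ (κ x) → ¬ IsTangency c₁ c₂ (κ x) z) :
    ∃ e ∈ edges (ρ '' {p | IsTangency c₁ c₂ p.1.1 p.1.2}), ¬ IsCompact (closure e) := by
  set g : ℝ → Y := fun x => ρ ⟨(κ x, x), hmem x⟩ with hg
  have hgc : Continuous g :=
    h.isQuotientMap.continuous.comp (Continuous.subtype_mk (by fun_prop) _)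
  have hgV : g '' Q ⊆ (ρ '' {p | IsTangency c₁ c₂ p.1.1 p.1.2})ᶜ := by
    rintro _ ⟨x, hx, rfl⟩ ⟨p, hp, hpx⟩
    obtain ⟨h1, h2⟩ := (h.eq_iff _ _).1 hpx.symm
    simp only at h1 h2
    exact htan x hx p.1.2 h2 (h1 ▸ hp)
  obtain ⟨x₀, hx₀⟩ := Filter.nonempty_of_mem hQl
  refine ⟨_, ⟨g x₀, hgV ⟨x₀, hx₀, rfl⟩, rfl⟩, fun hcpt => ?_⟩
  have hsub := (hQ.image g hgc.continuousOn).subset_connectedComponentIn ⟨x₀, hx₀, rfl⟩ hgV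
  -- A cluster point of the curve would have an open box as neighbourhood, which confines `x` to a
  -- bounded interval, whereas `x` leaves all of these along `l`.
  obtain ⟨y, -, hy⟩ := hcpt.exists_mapClusterPt (f := l) (u := g) (by
    rw [le_principal_iff, mem_map]
    filter_upwards [hQl] with x hx
    exact subset_closure (hsub ⟨x, hx, rfl⟩))
  obtain ⟨⟨⟨t, z⟩, hz⟩, rfl⟩ := h.isQuotientMap.surjective y
  have hz' : z ∈ slice c₁ c₂ t := hz
  obtain ⟨a, b, δ, haz, hzb, hδ, hends, -, -⟩ := hbox t z hz'
  have hends' : ∀ s ∈ Ioo (t - δ) (t + δ), a ∉ slice c₁ c₂ s ∧ b ∉ slice c₁ c₂ s := by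
    intro s hs
    refine hends s ?_
    rw [abs_le]
    constructor <;> linarith [hs.1, hs.2]
  have hfreq := hy.frequently ((h.isOpen_image_box hends').mem_nhds
    ⟨⟨(t, z), hz⟩, ⟨⟨haz, hzb⟩, by simp [hδ]⟩, rfl⟩)
  obtain ⟨x, ⟨p, ⟨hp, hp'⟩, hpx⟩, hx⟩ := (hfreq.and_eventually (hl a b)).exists
  obtain ⟨-, h2⟩ := (h.eq_iff _ _).1 hpx
  exact hx (Ioo_subset_Icc_self (mem_Ioo_of_uIcc_subset (hends' _ hp').1 (hends' _ hp').2 h2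
    (Ioo_subset_Icc_self hp)))

/-- An edge leaves every compact part of the strip towards an end. -/
theorem frequently_cocompact (h : IsSliceQuotient ρ f) (hf : Continuous f)
    (h₁ : Continuous c₁) (h₂ : Continuous c₂)
    {e : Set Y} {β : ℝ} (hβ : β ∉ f '' closure e) (hβ' : β ∈ closure (f '' e))
    {ε : ℝ} (hε : 0 < ε) :
    ∃ᶠ x in atBot ⊔ atTop, ∃ p : strip c₁ c₂, p.1.2 = x ∧ ρ p ∈ e ∧ |p.1.1 - β| < ε := by
  rw [← cocompact_eq_atBot_atTop, (Metric.cobounded_eq_cocompact (α := ℝ)).symm,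
    (Metric.hasBasis_cobounded_compl_closedBall (0 : ℝ)).frequently_iff]
  intro M _
  -- Over `[-M, M]` the closed edge attains only a closed set of levels near `β`, and `β` is not
  -- among them. Levels of `e` close enough to `β` thus come from outside `[-M, M]`.
  have hcl : IsClosed (f '' (closure e ∩
      ρ '' {p | p.1.2 ∈ Icc (-M) M ∧ p.1.1 ∈ Icc (β - 1) (β + 1)})) :=
    ((((isCompact_box h₁ h₂ _ _ _ _).image h.isQuotientMap.continuous).inter_left
      isClosed_closure).image hf).isClosed
  have hnot : β ∈ (f '' (closure e ∩
      ρ '' {p | p.1.2 ∈ Icc (-M) M ∧ p.1.1 ∈ Icc (β - 1) (β + 1)}))ᶜ :=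
    fun hmem => hβ (image_mono inter_subset_left hmem)
  obtain ⟨_, ⟨hs, hsε⟩, w, hw, rfl⟩ := mem_closure_iff_nhds.1 hβ' _
    (inter_mem (hcl.isOpen_compl.mem_nhds hnot) (Metric.ball_mem_nhds β (lt_min hε one_pos)))
  obtain ⟨p, rfl⟩ := h.isQuotientMap.surjective w
  rw [h.level, Metric.mem_ball, Real.dist_eq, lt_min_iff] at hsε
  refine ⟨p.1.2, fun hM => hs ⟨ρ p, ⟨subset_closure hw, p, ⟨?_, ?_⟩, rfl⟩, rfl⟩,
    p, rfl, hw, hsε.1⟩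
  · simpa [abs_le] using hM
  · have := abs_lt.1 hsε.2
    constructor <;> linarith [this.1, this.2]

variable [T2Space Y] {V e : Set Y}

/-- Over an interval on which the boundary curves are close to the level of an end of the edge `e`,
the strip belongs to `e` entirely or not at all. -/
theorem forall_mem_edge (h : IsSliceQuotient ρ f) (hL : IsLevelFunction f V)
    (h₁ : Continuous c₁) (h₂ : Continuous c₂) (hlt : ∀ x, c₁ x < c₂ x) (he : e ∈ edges V)
    {β : ℝ} (hβ : β ∉ f '' closure e) (hβ' : β ∈ closure (f '' e)) {w₀ : Y} (hw₀ : w₀ ∈ e)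
    {Q : Set ℝ} (hQ : IsPreconnected Q)
    (hQβ : ∀ x ∈ Q, |c₁ x - β| < |f w₀ - β| ∧ |c₂ x - β| < |f w₀ - β|)
    (hex : ∃ p, p.1.2 ∈ Q ∧ ρ p ∈ e) (p : strip c₁ c₂) (hp : p.1.2 ∈ Q) : ρ p ∈ e := by
  have hopen : IsOpen (ρ ⁻¹' e) :=
    (hL.isOpen_and_injOn_edge he).1.preimage h.isQuotientMap.continuous
  have hT : (f '' closure e).OrdConnected :=
    ((isPreconnected_edge he).closure.image f hL.continuous.continuousOn).ordConnected
  have hE : (f '' e).OrdConnected :=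
    ((isPreconnected_edge he).image f hL.continuous.continuousOn).ordConnected
  refine (isPreconnected_strip_over h₁ h₂ hlt hQ).subset_of_closure_inter_subset hopen hex ?_ hp
  rintro r ⟨hr, hrQ⟩
  have hrQ : r.1.2 ∈ Q := hrQ
  have hre : ρ r ∈ closure e := h.isQuotientMap.continuous.closure_preimage_subset _ hr
  have hlev := h.level r
  obtain ⟨hr1, hr2⟩ : c₁ r.1.2 ≤ r.1.1 ∧ r.1.1 ≤ c₂ r.1.2 := r.2
  obtain ⟨hb1, hb2⟩ := hQβ _ hrQ
  have hw₀T : f w₀ ∈ f '' closure e := ⟨w₀, subset_closure hw₀, rfl⟩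
  have hrT : r.1.1 ∈ f '' closure e := ⟨ρ r, hre, hlev⟩
  -- The levels of `closure e` form an interval without `β`, so the level of `r` lies on the same
  -- side of `β` as `f w₀`, and by `hQβ` it is closer to `β`. As `e` has levels arbitrarily near
  -- `β`, it attains this one.
  have hmem : r.1.1 ∈ f '' e := by
    rcases lt_trichotomy (f w₀) β with hlt' | heq | hgt
    · have hrβ : r.1.1 < β := by
        by_contra hcon
        exact hβ (hT.out hw₀T hrT ⟨hlt'.le, not_lt.1 hcon⟩)
      rw [abs_of_neg (by linarith : f w₀ - β < 0)] at hb1 hb2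
      have := (abs_lt.1 hb1).1
      obtain ⟨_, hs, w, hw, rfl⟩ := mem_closure_iff_nhds.1 hβ' _ (Ioi_mem_nhds hrβ)
      exact hE.out ⟨w₀, hw₀, rfl⟩ ⟨w, hw, rfl⟩ ⟨by linarith, le_of_lt hs⟩
    · exact absurd (heq ▸ hw₀T) hβ
    · have hrβ : β < r.1.1 := by
        by_contra hcon
        exact hβ (hT.out hrT hw₀T ⟨not_lt.1 hcon, hgt.le⟩)
      rw [abs_of_pos (by linarith : 0 < f w₀ - β)] at hb1 hb2
      have := (abs_lt.1 hb2).2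
      obtain ⟨_, hs, w, hw, rfl⟩ := mem_closure_iff_nhds.1 hβ' _ (Iio_mem_nhds hrβ)
      exact hE.out ⟨w, hw, rfl⟩ ⟨w₀, hw₀, rfl⟩ ⟨le_of_lt hs, by linarith⟩
  obtain ⟨w, hw, hwr⟩ := hmem
  have : w = ρ r := hL.injOn_closure_edge he (subset_closure hw) hre (hwr.trans hlev.symm)
  exact (this ▸ hw : ρ r ∈ e)

/-- The edge has points along `l` with levels near `β`, squeezed between `c₁` and `c₂`, which forces
`β = q`. Then `forall_mem_edge` applies to a connected set of `l` on which both curves are closer to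
`β` than some level of the edge. -/
theorem eventually_mem_edge (h : IsSliceQuotient ρ f) (hL : IsLevelFunction f V)
    (h₁ : Continuous c₁) (h₂ : Continuous c₂) (hlt : ∀ x, c₁ x < c₂ x) (he : e ∈ edges V)
    {β q : ℝ} (hβ : β ∉ f '' closure e) (hβ' : β ∈ closure (f '' e)) {l : Filter ℝ}
    (hl : ∀ S ∈ l, ∃ Q ∈ l, Q ⊆ S ∧ IsPreconnected Q) (hq₁ : Tendsto c₁ l (𝓝 q))
    (hq₂ : Tendsto c₂ l (𝓝 q))
    (hfreq : ∀ ε > 0, ∃ᶠ x in l, ∃ p : strip c₁ c₂, p.1.2 = x ∧ ρ p ∈ e ∧ |p.1.1 - β| < ε) :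
    β = q ∧ ∀ᶠ x in l, ∀ p : strip c₁ c₂, p.1.2 = x → ρ p ∈ e := by
  have hβq : β = q := by
    by_contra hne
    have hε : 0 < |β - q| / 2 := by
      have := abs_pos.2 (sub_ne_zero.2 hne)
      linarith
    obtain ⟨_, ⟨p, rfl, -, hp⟩, hx₁, hx₂⟩ := ((hfreq _ hε).and_eventually
      ((hq₁.eventually (Metric.ball_mem_nhds q hε)).and
        (hq₂.eventually (Metric.ball_mem_nhds q hε)))).exists
    obtain ⟨hp1, hp2⟩ : c₁ p.1.2 ≤ p.1.1 ∧ p.1.1 ≤ c₂ p.1.2 := p.2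
    rw [Real.dist_eq, abs_lt] at hx₁ hx₂
    rw [abs_lt] at hp
    rcases abs_cases (β - q) with hc | hc <;> linarith [hx₁.1, hx₂.2, hp.1, hp.2]
  refine ⟨hβq, ?_⟩
  subst hβq
  obtain ⟨w₀, hw₀⟩ := edge_nonempty he
  have hη : 0 < |f w₀ - β| := by
    refine abs_pos.2 (sub_ne_zero.2 ?_)
    rintro rfl
    exact hβ ⟨w₀, subset_closure hw₀, rfl⟩
  obtain ⟨Q, hQl, hQ, hQc⟩ := hl _ (inter_mem (hq₁ (Metric.ball_mem_nhds β hη))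
    (hq₂ (Metric.ball_mem_nhds β hη)))
  have hex : ∃ p, p.1.2 ∈ Q ∧ ρ p ∈ e := by
    obtain ⟨_, ⟨p, rfl, hp, -⟩, hxQ⟩ := ((hfreq 1 one_pos).and_eventually hQl).exists
    exact ⟨p, hxQ, hp⟩
  filter_upwards [hQl] with x hx p hpx
  refine h.forall_mem_edge hL h₁ h₂ hlt he hβ hβ' hw₀ hQc (fun x hx => ?_) hex p (hpx ▸ hx)
  simpa [Real.dist_eq] using hQ hx

/-- An edge with an end forces both boundary curves to be free of critical points near infinity, on
one side of the limiting level. -/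
theorem exists_regular_end (h : IsSliceQuotient ρ f)
    (hL : IsLevelFunction f (ρ '' {p | IsTangency c₁ c₂ p.1.1 p.1.2}))
    (h₁ : Continuous c₁) (h₂ : Continuous c₂) (hlt : ∀ x, c₁ x < c₂ x)
    (he : e ∈ edges (ρ '' {p | IsTangency c₁ c₂ p.1.1 p.1.2}))
    {β q : ℝ} (hβ : β ∉ f '' closure e) (hβ' : β ∈ closure (f '' e)) {l : Filter ℝ}
    (hl : ∀ S ∈ l, ∃ Q ∈ l, Q ⊆ S ∧ IsPreconnected Q) (hq₁ : Tendsto c₁ l (𝓝 q))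
    (hq₂ : Tendsto c₂ l (𝓝 q))
    (hfreq : ∀ ε > 0, ∃ᶠ x in l, ∃ p : strip c₁ c₂, p.1.2 = x ∧ ρ p ∈ e ∧ |p.1.1 - β| < ε) :
    (∀ᶠ x in l, deriv c₁ x ≠ 0) ∧ (∀ᶠ x in l, deriv c₂ x ≠ 0) ∧
      ((∀ᶠ x in l, c₂ x < q) ∨ ∀ᶠ x in l, q < c₁ x) := by
  obtain ⟨rfl, hev⟩ := h.eventually_mem_edge hL h₁ h₂ hlt he hβ hβ' hl hq₁ hq₂ hfreq
  have hT : (f '' closure e).OrdConnected :=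
    ((isPreconnected_edge he).closure.image f hL.continuous.continuousOn).ordConnected
  have hmem₁ : ∀ x, (c₁ x, x) ∈ strip c₁ c₂ := fun x => ⟨le_rfl, (hlt x).le⟩
  have hmem₂ : ∀ x, (c₂ x, x) ∈ strip c₁ c₂ := fun x => ⟨(hlt x).le, le_rfl⟩
  refine ⟨?_, ?_, ?_⟩
  · filter_upwards [hev] with x hx hd
    exact edge_subset_compl he (hx ⟨_, hmem₁ x⟩ rfl) ⟨_, Or.inl ⟨rfl, hd⟩, rfl⟩
  · filter_upwards [hev] with x hx hd
    exact edge_subset_compl he (hx ⟨_, hmem₂ x⟩ rfl) ⟨_, Or.inr ⟨rfl, hd⟩, rfl⟩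
  · obtain ⟨w₀, hw₀⟩ := edge_nonempty he
    have hw₀T : f w₀ ∈ f '' closure e := ⟨w₀, subset_closure hw₀, rfl⟩
    rcases le_total (f w₀) β with hle | hle
    · left
      filter_upwards [hev] with x hx
      by_contra hcon
      exact hβ (hT.out hw₀T ⟨_, subset_closure (hx ⟨_, hmem₂ x⟩ rfl), h.level _⟩
        ⟨hle, not_lt.1 hcon⟩)
    · right
      filter_upwards [hev] with x hx
      by_contra hcon
      exact hβ (hT.out ⟨_, subset_closure (hx ⟨_, hmem₁ x⟩ rfl), h.level _⟩ hw₀T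
        ⟨not_lt.1 hcon, hle⟩)

end IsSliceQuotient

end Ends

/-! ### The manifold over the strip and its critical points. -/

section Manifold

section Prod

variable {E F : Type*} [NormedAddCommGroup E] [NormedSpace ℝ E] [NormedAddCommGroup F]
  [NormedSpace ℝ F]

theorem hasDerivAt_fst_comp {γ : ℝ → E × F} {v : E × F} {t : ℝ} (h : HasDerivAt γ v t) :
    HasDerivAt (fun τ => (γ τ).1) v.1 t :=
  HasFDerivAt.comp_hasDerivAt (l := (Prod.fst : E × F → E)) t
    (ContinuousLinearMap.fst ℝ E F).hasFDerivAt h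

theorem hasDerivAt_snd_comp {γ : ℝ → E × F} {v : E × F} {t : ℝ} (h : HasDerivAt γ v t) :
    HasDerivAt (fun τ => (γ τ).2) v.2 t :=
  HasFDerivAt.comp_hasDerivAt (l := (Prod.snd : E × F → F)) t
    (ContinuousLinearMap.snd ℝ E F).hasFDerivAt h

end Prod

variable {m : ℕ} {c₁ c₂ : ℝ → ℝ}

theorem mem_closure_region_iff (h₁ : Continuous c₁) (h₂ : Continuous c₂)
    (hlt : ∀ x, c₁ x < c₂ x) {s x : ℝ} :
    (s, x) ∈ closure (region c₁ c₂) ↔ x ∈ slice c₁ c₂ s := by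
  constructor
  · intro h
    have hsub : region c₁ c₂ ⊆ strip c₁ c₂ := fun p hp => ⟨hp.1.le, hp.2.le⟩
    exact closure_minimal hsub (isClosed_strip h₁ h₂) h
  · intro h
    have hs : s ∈ closure (Ioo (c₁ x) (c₂ x)) := by
      rw [closure_Ioo (hlt x).ne]
      exact h
    have hcont : Continuous fun s : ℝ => (s, x) := by fun_prop
    exact closure_mono (by rintro _ ⟨s', hs', rfl⟩; exact hs')
      (image_closure_subset_closure_image hcont ⟨s, hs, rfl⟩)

/-- The closure condition is redundant: a sum of squares is non-negative, and `stripFn` is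
non-negative only on the strip. -/
theorem mem_manifoldX_iff (h₁ : Continuous c₁) (h₂ : Continuous c₂) (hlt : ∀ x, c₁ x < c₂ x)
    {p : Ambient m} :
    p ∈ manifoldX m c₁ c₂ ↔ stripFn c₁ c₂ p.1 p.2.1 = ∑ j, p.2.2 j ^ 2 := by
  rw [manifoldX, mem_ofPred_eq, mem_closure_region_iff h₁ h₂ hlt, ← stripFn_nonneg_iff hlt]
  constructor
  · rintro ⟨-, h⟩
    exact sub_eq_zero.1 h
  · intro h
    exact ⟨h ▸ Finset.sum_nonneg fun j _ => sq_nonneg _, sub_eq_zero.2 h⟩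

theorem mem_slice_of_mem_manifoldX (h₁ : Continuous c₁) (h₂ : Continuous c₂)
    (hlt : ∀ x, c₁ x < c₂ x) (p : manifoldX m c₁ c₂) : p.1.2.1 ∈ slice c₁ c₂ p.1.1 :=
  (mem_closure_region_iff h₁ h₂ hlt).1 p.2.1

theorem lift_mem_manifoldX (h₁ : Continuous c₁) (h₂ : Continuous c₂) (hlt : ∀ x, c₁ x < c₂ x)
    {u : Fin (m - 1) → ℝ} (hu : ∑ j, u j ^ 2 = 1) {s x : ℝ} (h : x ∈ slice c₁ c₂ s) :
    ((s, x, √(stripFn c₁ c₂ s x) • u) : Ambient m) ∈ manifoldX m c₁ c₂ := by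
  rw [mem_manifoldX_iff h₁ h₂ hlt]
  simp only [Pi.smul_apply, smul_eq_mul, mul_pow, ← Finset.mul_sum, hu, mul_one]
  rw [Real.sq_sqrt ((stripFn_nonneg_iff hlt).2 h)]

/-- Normalise the fibre coordinate. On the boundary it is zero and any unit vector serves, hence the
spare `u₀`. -/
theorem exists_eq_lift (h₁ : Continuous c₁) (h₂ : Continuous c₂) (hlt : ∀ x, c₁ x < c₂ x)
    {u₀ : Fin (m - 1) → ℝ} (hu₀ : ∑ j, u₀ j ^ 2 = 1) (p : manifoldX m c₁ c₂) :
    ∃ u : Fin (m - 1) → ℝ, ∑ j, u j ^ 2 = 1 ∧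
      p.1 = (p.1.1, p.1.2.1, √(stripFn c₁ c₂ p.1.1 p.1.2.1) • u) := by
  have hp := (mem_manifoldX_iff h₁ h₂ hlt).1 p.2
  have hnn := (stripFn_nonneg_iff hlt).2 (mem_slice_of_mem_manifoldX h₁ h₂ hlt p)
  rcases hnn.eq_or_lt with h0 | hpos
  · refine ⟨u₀, hu₀, Prod.ext rfl (Prod.ext rfl ?_)⟩
    rw [← h0] at hp ⊢
    rw [eq_comm, Finset.sum_eq_zero_iff_of_nonneg fun j _ => sq_nonneg _] at hp
    funext j
    simpa using hp j (Finset.mem_univ j)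
  · have hne : √(stripFn c₁ c₂ p.1.1 p.1.2.1) ≠ 0 := (Real.sqrt_pos.2 hpos).ne'
    refine ⟨(√(stripFn c₁ c₂ p.1.1 p.1.2.1))⁻¹ • p.1.2.2, ?_, Prod.ext rfl (Prod.ext rfl ?_)⟩
    · simp only [Pi.smul_apply, smul_eq_mul, mul_pow, ← Finset.mul_sum, ← hp, inv_pow]
      rw [Real.sq_sqrt hnn, inv_mul_cancel₀ hpos.ne']
    · simp only
      rw [smul_smul, mul_inv_cancel₀ hne, one_smul]

theorem fderiv_proj (p v : Ambient m) : fderiv ℝ (proj m) p v = v.1 := by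
  have : proj m = (ContinuousLinearMap.fst ℝ ℝ (ℝ × (Fin (m - 1) → ℝ)) : Ambient m → ℝ) := rfl
  rw [this, ContinuousLinearMap.fderiv]
  rfl

/-- At a tangency `y = 0`, so the sum of squares has derivative zero along any curve.
Differentiating the equation leaves `v.1` times the non-vanishing factor. -/
theorem mem_critX_of_isTangency (hc₁ : Differentiable ℝ c₁) (hc₂ : Differentiable ℝ c₂)
    (hlt : ∀ x, c₁ x < c₂ x) {p : manifoldX m c₁ c₂}
    (h : IsTangency c₁ c₂ p.1.1 p.1.2.1) : p ∈ critX m c₁ c₂ := by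
  rintro v ⟨ε, hε, γ, -, hγ, hγ0, hγv⟩
  rw [fderiv_proj]
  have d1 : HasDerivAt (fun τ => (γ τ).1) v.1 0 := hasDerivAt_fst_comp hγv
  have d2 : HasDerivAt (fun τ => (γ τ).2.1) v.2.1 0 :=
    hasDerivAt_fst_comp (hasDerivAt_snd_comp hγv)
  have d3 : HasDerivAt (fun τ => (γ τ).2.2) v.2.2 0 :=
    hasDerivAt_snd_comp (hasDerivAt_snd_comp hγv)
  have hp := (mem_manifoldX_iff hc₁.continuous hc₂.continuous hlt).1 p.2
  rw [((isTangency_iff hlt).1 h).1, eq_comm,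
    Finset.sum_eq_zero_iff_of_nonneg fun j _ => sq_nonneg _] at hp
  have hy : ∀ j, (γ 0).2.2 j = 0 := fun j => by
    rw [hγ0]
    simpa using hp j (Finset.mem_univ j)
  have dsum : HasDerivAt (fun τ => ∑ j, (γ τ).2.2 j ^ 2) 0 0 := by
    have := HasDerivAt.fun_sum (u := Finset.univ) (A := fun j τ => (γ τ).2.2 j ^ 2)
      (A' := fun _ => (0 : ℝ)) (x := 0) fun j _ => by
        have := ((hasDerivAt_pi.1 d3) j).fun_pow 2
        simpa [hy j] using this
    simpa using this
  have e1 : HasDerivAt (fun τ => c₁ (γ τ).2.1) (deriv c₁ p.1.2.1 * v.2.1) 0 := by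
    refine HasDerivAt.comp (h₂ := c₁) 0 ?_ d2
    rw [hγ0]
    exact (hc₁ _).hasDerivAt
  have e2 : HasDerivAt (fun τ => c₂ (γ τ).2.1) (deriv c₂ p.1.2.1 * v.2.1) 0 := by
    refine HasDerivAt.comp (h₂ := c₂) 0 ?_ d2
    rw [hγ0]
    exact (hc₂ _).hasDerivAt
  have dF := ((d1.fun_sub e1).fun_mul (e2.fun_sub d1)).fun_sub dsum
  have hzero : (fun τ => ((γ τ).1 - c₁ (γ τ).2.1) * (c₂ (γ τ).2.1 - (γ τ).1) -
      ∑ j, (γ τ).2.2 j ^ 2) =ᶠ[𝓝 0] fun _ => 0 := by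
    filter_upwards [Ioo_mem_nhds (neg_lt_zero.2 hε) hε] with τ hτ
    exact (hγ τ hτ).2
  have hd := dF.unique ((hasDerivAt_const (0 : ℝ) (0 : ℝ)).congr_of_eventuallyEq hzero)
  simp only [hγ0] at hd
  have hx := hlt p.1.2.1
  rcases h with ⟨hs, hd0⟩ | ⟨hs, hd0⟩
  · rw [hd0, hs] at hd
    have : v.1 * (c₂ p.1.2.1 - p.1.1) = 0 := by linarith
    exact (mul_eq_zero.1 this).resolve_right (by linarith)
  · rw [hd0, hs] at hd
    have : (p.1.1 - c₁ p.1.2.1) * v.1 = 0 := by linarith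
    exact (mul_eq_zero.1 this).resolve_left (by linarith)

theorem deriv_fst_eq_zero_of_mem_critX {p : manifoldX m c₁ c₂} (h : p ∈ critX m c₁ c₂)
    {ε d : ℝ} (hε : 0 < ε) {γ : ℝ → Ambient m} (hγ : ContDiffOn ℝ ∞ γ (Ioo (-ε) ε))
    (hγX : ∀ s ∈ Ioo (-ε) ε, γ s ∈ manifoldX m c₁ c₂) (hγ0 : γ 0 = p)
    (hd : HasDerivAt (fun s => (γ s).1) d 0) : d = 0 := by
  have h0 : (0 : ℝ) ∈ Ioo (-ε) ε := ⟨by linarith, hε⟩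
  have hdiff : DifferentiableAt ℝ γ 0 :=
    (hγ.contDiffAt (Ioo_mem_nhds h0.1 h0.2)).differentiableAt (by simp)
  have hv := h (deriv γ 0) ⟨ε, hε, γ, hγ, hγX, hγ0, hdiff.hasDerivAt⟩
  rw [fderiv_proj] at hv
  have d1 : HasDerivAt (fun τ => (γ τ).1) (deriv γ 0).1 0 :=
    hasDerivAt_fst_comp hdiff.hasDerivAt
  rw [hd.unique d1, hv]

/-- Two test curves suffice. Over a boundary point, the boundary curve with `y = 0` has first
velocity `deriv c x`. Over an interior point, varying `s` with `x` and the fibre direction fixed has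
first velocity `1`, so such a point is never critical. -/
theorem isTangency_of_mem_critX (hc₁ : ContDiff ℝ ∞ c₁) (hc₂ : ContDiff ℝ ∞ c₂)
    (hlt : ∀ x, c₁ x < c₂ x) {u₀ : Fin (m - 1) → ℝ} (hu₀ : ∑ j, u₀ j ^ 2 = 1)
    {p : manifoldX m c₁ c₂} (h : p ∈ critX m c₁ c₂) : IsTangency c₁ c₂ p.1.1 p.1.2.1 := by
  have k₁ := hc₁.continuous
  have k₂ := hc₂.continuous
  obtain ⟨u, hu, hpu⟩ := exists_eq_lift k₁ k₂ hlt hu₀ p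
  set s := p.1.1 with hs
  set x := p.1.2.1 with hx
  have hnn := (stripFn_nonneg_iff hlt).2 (mem_slice_of_mem_manifoldX k₁ k₂ hlt p)
  have hcurve : ∀ {c : ℝ → ℝ}, ContDiff ℝ ∞ c → (∀ w, stripFn c₁ c₂ (c w) w = 0) → c x = s →
      deriv c x = 0 := by
    intro c hc hc0 hcx
    refine deriv_fst_eq_zero_of_mem_critX (γ := fun τ => (c (x + τ), x + τ, 0)) h one_pos
      (by fun_prop) ?_ ?_ ?_
    · intro τ _
      rw [mem_manifoldX_iff k₁ k₂ hlt]
      simp [hc0]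
    · rw [hpu]
      simp only [add_zero, ← hcx, hc0, Real.sqrt_zero, zero_smul]
    · have := (hc.differentiable (by simp) (x + 0)).hasDerivAt.comp_const_add x 0
      simpa using this
  rcases hnn.eq_or_lt with h0 | hpos
  · rcases mul_eq_zero.1 h0.symm with h' | h'
    · have hcx : c₁ x = s := by linarith
      exact Or.inl ⟨hcx, hcurve hc₁ (fun w => by simp [stripFn]) hcx⟩
    · have hcx : c₂ x = s := by linarith
      exact Or.inr ⟨hcx, hcurve hc₂ (fun w => by simp [stripFn]) hcx⟩
  · exfalso
    have hcont : Continuous fun τ => stripFn c₁ c₂ (s + τ) x :=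
      (continuous_stripFn k₁ k₂).comp (by fun_prop : Continuous fun τ => (s + τ, x))
    have hev : ∀ᶠ τ in 𝓝 (0 : ℝ), 0 < stripFn c₁ c₂ (s + τ) x :=
      hcont.continuousAt.eventually (lt_mem_nhds (by simpa using hpos))
    obtain ⟨ε, hε, H⟩ := Metric.eventually_nhds_iff.1 hev
    have H' : ∀ τ ∈ Ioo (-ε) ε, 0 < stripFn c₁ c₂ (s + τ) x := fun τ hτ =>
      H (by rw [Real.dist_eq, sub_zero, abs_lt]; exact hτ)
    have hsm : ContDiffOn ℝ ∞ (fun τ => √(stripFn c₁ c₂ (s + τ) x)) (Ioo (-ε) ε) := by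
      refine ContDiffOn.sqrt ?_ fun τ hτ => (H' τ hτ).ne'
      unfold stripFn
      fun_prop
    refine one_ne_zero (deriv_fst_eq_zero_of_mem_critX
      (γ := fun τ => (s + τ, x, √(stripFn c₁ c₂ (s + τ) x) • u)) h hε ?_ ?_ ?_ ?_)
    · exact ContDiffOn.prodMk (by fun_prop) (ContDiffOn.prodMk (by fun_prop)
        (hsm.smul contDiffOn_const))
    · intro τ hτ
      exact lift_mem_manifoldX k₁ k₂ hlt hu ((stripFn_nonneg_iff hlt).1 (H' τ hτ).le)
    · simp only [add_zero]
      exact hpu.symm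
    · simpa using (hasDerivAt_id (0 : ℝ)).const_add s

end Manifold

/-! ### Contours as components of slices. -/

section Contours

theorem mem_contour {X : Type*} [TopologicalSpace X] (f : X → ℝ) (x : X) : x ∈ contour f x :=
  mem_connectedComponentIn rfl

theorem level_eq_of_mem_contour {X : Type*} [TopologicalSpace X] {f : X → ℝ} {x y : X}
    (h : y ∈ contour f x) : f y = f x :=
  (connectedComponentIn_subset (f ⁻¹' {f x}) x h : y ∈ f ⁻¹' {f x})

theorem contour_eq_of_mem {X : Type*} [TopologicalSpace X] {f : X → ℝ} {x y : X}
    (h : y ∈ contour f x) : contour f y = contour f x := by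
  rw [contour, level_eq_of_mem_contour h]
  exact (connectedComponentIn_eq h).symm

theorem contour_eq_of_isPreconnected {X : Type*} [TopologicalSpace X] {f : X → ℝ} {x y : X}
    {S : Set X} (hS : IsPreconnected S) (hx : x ∈ S) (hy : y ∈ S) (hf : ∀ z ∈ S, f z = f x) :
    contour f x = contour f y :=
  (contour_eq_of_mem (hS.subset_connectedComponentIn hx hf hy)).symm

variable {m : ℕ} {c₁ c₂ : ℝ → ℝ}

/-- The section of the projection of the manifold to the strip in the direction of `u`. -/
noncomputable def lift (h₁ : Continuous c₁) (h₂ : Continuous c₂) (hlt : ∀ x, c₁ x < c₂ x)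
    {u : Fin (m - 1) → ℝ} (hu : ∑ j, u j ^ 2 = 1) (p : strip c₁ c₂) : manifoldX m c₁ c₂ :=
  ⟨(p.1.1, p.1.2, √(stripFn c₁ c₂ p.1.1 p.1.2) • u), lift_mem_manifoldX h₁ h₂ hlt hu p.2⟩

theorem continuous_lift (h₁ : Continuous c₁) (h₂ : Continuous c₂) (hlt : ∀ x, c₁ x < c₂ x)
    {u : Fin (m - 1) → ℝ} (hu : ∑ j, u j ^ 2 = 1) : Continuous (lift h₁ h₂ hlt hu) := by
  have hcont : Continuous fun p : strip c₁ c₂ => stripFn c₁ c₂ p.1.1 p.1.2 :=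
    (continuous_stripFn h₁ h₂).comp continuous_subtype_val
  exact Continuous.subtype_mk (by fun_prop) _

/-- The projection of the manifold to the strip. -/
def toStrip (h₁ : Continuous c₁) (h₂ : Continuous c₂) (hlt : ∀ x, c₁ x < c₂ x)
    (p : manifoldX m c₁ c₂) : strip c₁ c₂ :=
  ⟨(p.1.1, p.1.2.1), mem_slice_of_mem_manifoldX h₁ h₂ hlt p⟩

theorem continuous_toStrip (h₁ : Continuous c₁) (h₂ : Continuous c₂) (hlt : ∀ x, c₁ x < c₂ x) :
    Continuous (toStrip (m := m) h₁ h₂ hlt) :=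
  Continuous.subtype_mk (by fun_prop) _

theorem contour_lift_eq (h₁ : Continuous c₁) (h₂ : Continuous c₂) (hlt : ∀ x, c₁ x < c₂ x)
    {u : Fin (m - 1) → ℝ} (hu : ∑ j, u j ^ 2 = 1) {p q : strip c₁ c₂} (hl : p.1.1 = q.1.1)
    (hs : uIcc p.1.2 q.1.2 ⊆ slice c₁ c₂ p.1.1) :
    contour (projX m c₁ c₂) (lift h₁ h₂ hlt hu p) =
      contour (projX m c₁ c₂) (lift h₁ h₂ hlt hu q) := by
  set g : uIcc p.1.2 q.1.2 → strip c₁ c₂ := fun x => ⟨(p.1.1, x.1), hs x.2⟩ with hg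
  have hgc : Continuous g := Continuous.subtype_mk (by fun_prop) _
  have hconn : PreconnectedSpace (uIcc p.1.2 q.1.2) :=
    isPreconnected_iff_preconnectedSpace.1 isPreconnected_uIcc
  refine contour_eq_of_isPreconnected (S := range fun x => lift h₁ h₂ hlt hu (g x))
    (isPreconnected_range ((continuous_lift h₁ h₂ hlt hu).comp hgc))
    ⟨⟨p.1.2, left_mem_uIcc⟩, rfl⟩ ⟨⟨q.1.2, right_mem_uIcc⟩, ?_⟩ ?_
  · simp only [hg, hl]
  · rintro _ ⟨x, rfl⟩
    rfl

/-- The second coordinate maps the connected contour onto an interval inside the slice. -/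
theorem uIcc_subset_of_contour_eq (h₁ : Continuous c₁) (h₂ : Continuous c₂)
    (hlt : ∀ x, c₁ x < c₂ x) {p q : manifoldX m c₁ c₂}
    (h : contour (projX m c₁ c₂) p = contour (projX m c₁ c₂) q) :
    p.1.1 = q.1.1 ∧ uIcc p.1.2.1 q.1.2.1 ⊆ slice c₁ c₂ p.1.1 := by
  have hq : q ∈ contour (projX m c₁ c₂) p := h ▸ mem_contour _ q
  refine ⟨(level_eq_of_mem_contour hq).symm, ?_⟩
  have hpre : IsPreconnected ((fun r : manifoldX m c₁ c₂ => r.1.2.1) ''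
      contour (projX m c₁ c₂) p) :=
    isPreconnected_connectedComponentIn.image _ (by fun_prop)
  refine (hpre.ordConnected.uIcc_subset ⟨p, mem_contour _ p, rfl⟩ ⟨q, hq, rfl⟩).trans ?_
  rintro _ ⟨r, hr, rfl⟩
  have hrp : r.1.1 = p.1.1 := level_eq_of_mem_contour (f := projX m c₁ c₂) hr
  exact hrp ▸ mem_slice_of_mem_manifoldX h₁ h₂ hlt r

/-- If the components of the slices are bounded, the direction of the fibre does not matter. -/
theorem contour_lift_toStrip (h₁ : Continuous c₁) (h₂ : Continuous c₂) (hlt : ∀ x, c₁ x < c₂ x)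
    (hbd : ∀ s, ∀ x ∈ slice c₁ c₂ s, ∃ b > x, b ∉ slice c₁ c₂ s) {u : Fin (m - 1) → ℝ}
    (hu : ∑ j, u j ^ 2 = 1) (p : manifoldX m c₁ c₂) :
    contour (projX m c₁ c₂) (lift h₁ h₂ hlt hu (toStrip h₁ h₂ hlt p)) =
      contour (projX m c₁ c₂) p := by
  obtain ⟨u', hu', hp⟩ := exists_eq_lift h₁ h₂ hlt hu p
  have hp' : p = lift h₁ h₂ hlt hu' (toStrip h₁ h₂ hlt p) := Subtype.ext hp
  have hx := mem_slice_of_mem_manifoldX h₁ h₂ hlt p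
  obtain ⟨b', hb', hb's⟩ := hbd _ _ hx
  -- Over the right end of the component the fibre is a point, so there the lifts in the directions
  -- `u` and `u'` agree.
  obtain ⟨b, hb, hb0, hpos, -⟩ := exists_right_end (φ := stripFn c₁ c₂ p.1.1)
    ((continuous_stripFn h₁ h₂).comp (by fun_prop : Continuous fun x => (p.1.1, x)))
    ((stripFn_neg_iff hlt).2 hb's) hb' ((stripFn_nonneg_iff hlt).2 hx)
  have hsub : uIcc p.1.2.1 b ⊆ slice c₁ c₂ p.1.1 := by
    rw [uIcc_of_le hb.1]
    exact fun w hw => (stripFn_nonneg_iff hlt).1 (hpos w hw)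
  set q : strip c₁ c₂ := ⟨(p.1.1, b), hsub right_mem_uIcc⟩ with hq
  have hqq : lift h₁ h₂ hlt hu q = lift h₁ h₂ hlt hu' q := by
    refine Subtype.ext ?_
    simp only [lift, hq, hb0, Real.sqrt_zero, zero_smul]
  conv_rhs => rw [hp']
  rw [contour_lift_eq h₁ h₂ hlt hu (p := toStrip h₁ h₂ hlt p) (q := q) rfl hsub, hqq,
    contour_lift_eq h₁ h₂ hlt hu' (p := toStrip h₁ h₂ hlt p) (q := q) rfl hsub]

/-- The map of the strip to the Reeb space. -/
noncomputable def toReeb (h₁ : Continuous c₁) (h₂ : Continuous c₂) (hlt : ∀ x, c₁ x < c₂ x)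
    {u : Fin (m - 1) → ℝ} (hu : ∑ j, u j ^ 2 = 1) (p : strip c₁ c₂) :
    ReebSpace (projX m c₁ c₂) :=
  Quotient.mk (contourSetoid (projX m c₁ c₂)) (lift h₁ h₂ hlt hu p)

/-- The function induced on the Reeb space. -/
def reebLevel {X : Type*} [TopologicalSpace X] (f : X → ℝ) : ReebSpace f → ℝ :=
  Quotient.lift f fun x y (h : contour f x = contour f y) =>
    (level_eq_of_mem_contour (h ▸ mem_contour f y : y ∈ contour f x)).symm

/-- The quotient map of the manifold factors as `toReeb ∘ toStrip`, so the second factor is a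
quotient map too. -/
theorem isSliceQuotient_toReeb (h₁ : Continuous c₁) (h₂ : Continuous c₂)
    (hlt : ∀ x, c₁ x < c₂ x) (hbd : ∀ s, ∀ x ∈ slice c₁ c₂ s, ∃ b > x, b ∉ slice c₁ c₂ s)
    {u : Fin (m - 1) → ℝ} (hu : ∑ j, u j ^ 2 = 1) :
    IsSliceQuotient (toReeb h₁ h₂ hlt hu) (reebLevel (projX m c₁ c₂)) where
  isQuotientMap := by
    have hcomp : toReeb h₁ h₂ hlt hu ∘ toStrip h₁ h₂ hlt =
        Quotient.mk (contourSetoid (projX m c₁ c₂)) :=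
      funext fun p => Quotient.sound (contour_lift_toStrip h₁ h₂ hlt hbd hu p)
    refine IsQuotientMap.of_comp (continuous_toStrip (m := m) h₁ h₂ hlt)
      (continuous_quotient_mk'.comp (continuous_lift h₁ h₂ hlt hu)) ?_
    rw [hcomp]
    exact isQuotientMap_quotient_mk'
  level p := rfl
  eq_iff p q := by
    constructor
    · intro h
      exact uIcc_subset_of_contour_eq h₁ h₂ hlt (Quotient.exact h)
    · rintro ⟨hl, hs⟩
      exact Quotient.sound (contour_lift_eq h₁ h₂ hlt hu hl hs)

theorem contoursMeeting_critX (hc₁ : ContDiff ℝ ∞ c₁) (hc₂ : ContDiff ℝ ∞ c₂)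
    (hlt : ∀ x, c₁ x < c₂ x) (hbd : ∀ s, ∀ x ∈ slice c₁ c₂ s, ∃ b > x, b ∉ slice c₁ c₂ s)
    {u : Fin (m - 1) → ℝ} (hu : ∑ j, u j ^ 2 = 1) :
    contoursMeeting (projX m c₁ c₂) (critX m c₁ c₂) =
      toReeb hc₁.continuous hc₂.continuous hlt hu '' {p | IsTangency c₁ c₂ p.1.1 p.1.2} := by
  ext y
  constructor
  · rintro ⟨p, hp, rfl⟩
    exact ⟨toStrip hc₁.continuous hc₂.continuous hlt p, isTangency_of_mem_critX hc₁ hc₂ hlt hu hp,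
      Quotient.sound (contour_lift_toStrip hc₁.continuous hc₂.continuous hlt hbd hu p)⟩
  · rintro ⟨p, hp, rfl⟩
    exact ⟨lift hc₁.continuous hc₂.continuous hlt hu p, mem_critX_of_isTangency
      (hc₁.differentiable (by simp)) (hc₂.differentiable (by simp)) hlt hp, rfl⟩

end Contours

/-! ### Existence of boxes from the hypotheses. -/

section Boxes

variable {c₁ c₂ : ℝ → ℝ}

/-- The boxes exist if components of slices are bounded and isolated in their slices, and tangencies
do not accumulate at the strip from other levels. -/
theorem hasBoxes_of_local (h₁ : Continuous c₁) (h₂ : Continuous c₂) (hlt : ∀ x, c₁ x < c₂ x)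
    (hbelow : ∀ s, ∀ x ∈ slice c₁ c₂ s, ∃ a < x, a ∉ slice c₁ c₂ s)
    (habove : ∀ s, ∀ x ∈ slice c₁ c₂ s, ∃ b > x, b ∉ slice c₁ c₂ s)
    (hiso : ∀ t, ∀ x₁ ∈ slice c₁ c₂ t, ∀ᶠ x in 𝓝 x₁, x ∈ slice c₁ c₂ t →
      uIcc x₁ x ⊆ slice c₁ c₂ t)
    (htan : ∀ t, ∀ x₁ ∈ slice c₁ c₂ t, ∀ᶠ p : ℝ × ℝ in 𝓝 (t, x₁),
      IsTangency c₁ c₂ p.1 p.2 → p.1 = t) : HasBoxes c₁ c₂ := by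
  intro t x₀ hx₀
  have hφ := continuous_stripFn h₁ h₂
  have hφt : Continuous (stripFn c₁ c₂ t) := hφ.comp (by fun_prop : Continuous fun x => (t, x))
  have hφx : ∀ x, Continuous fun s => stripFn c₁ c₂ s x := fun x =>
    hφ.comp (by fun_prop : Continuous fun s => (s, x))
  obtain ⟨a', ha', ha's⟩ := hbelow t x₀ hx₀
  obtain ⟨b', hb', hb's⟩ := habove t x₀ hx₀
  obtain ⟨a₀, ha₀, ha0, hapos, hafreq⟩ := exists_left_end hφt ((stripFn_neg_iff hlt).2 ha's) ha'
    ((stripFn_nonneg_iff hlt).2 hx₀)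
  obtain ⟨b₀, hb₀, hb0, hbpos, hbfreq⟩ := exists_right_end hφt ((stripFn_neg_iff hlt).2 hb's) hb'
    ((stripFn_nonneg_iff hlt).2 hx₀)
  -- A slice point just left of `a₀` would be joined to `a₀` inside the slice, but points outside
  -- the slice accumulate at `a₀` from the left.
  have hleft : ∃ a < a₀, ∀ x ∈ Ico a a₀, x ∉ slice c₁ c₂ t := by
    obtain ⟨r, hr, H⟩ := Metric.eventually_nhds_iff.1
      (hiso t a₀ ((stripFn_nonneg_iff hlt).1 ha0.ge))
    refine ⟨a₀ - r / 2, by linarith, fun x hx hxs => ?_⟩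
    have hsub := H (y := x) (by rw [Real.dist_eq, abs_lt]; constructor <;> linarith [hx.1, hx.2])
      hxs
    obtain ⟨z, hz, hzx⟩ := (hafreq.and_eventually (Ioo_mem_nhdsLT hx.2)).exists
    refine (stripFn_neg_iff hlt).1 hz (hsub ?_)
    rw [uIcc_of_ge hx.2.le]
    exact ⟨hzx.1.le, hzx.2.le⟩
  have hright : ∃ b > b₀, ∀ x ∈ Ioc b₀ b, x ∉ slice c₁ c₂ t := by
    obtain ⟨r, hr, H⟩ := Metric.eventually_nhds_iff.1
      (hiso t b₀ ((stripFn_nonneg_iff hlt).1 hb0.ge))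
    refine ⟨b₀ + r / 2, by linarith, fun x hx hxs => ?_⟩
    have hsub := H (y := x) (by rw [Real.dist_eq, abs_lt]; constructor <;> linarith [hx.1, hx.2])
      hxs
    obtain ⟨z, hz, hzx⟩ := (hbfreq.and_eventually (Ioo_mem_nhdsGT hx.1)).exists
    refine (stripFn_neg_iff hlt).1 hz (hsub ?_)
    rw [uIcc_of_le hx.1.le]
    exact ⟨hzx.1.le, hzx.2.le⟩
  obtain ⟨a, haa₀, haL⟩ := hleft
  obtain ⟨b, hbb₀, hbR⟩ := hright
  have hends : ∀ᶠ s in 𝓝 t, a ∉ slice c₁ c₂ s ∧ b ∉ slice c₁ c₂ s := by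
    simp only [← stripFn_neg_iff hlt]
    exact ((hφx a).continuousAt.eventually (gt_mem_nhds
      ((stripFn_neg_iff hlt).2 (haL a ⟨le_rfl, haa₀⟩)))).and
      ((hφx b).continuousAt.eventually (gt_mem_nhds
      ((stripFn_neg_iff hlt).2 (hbR b ⟨hbb₀, le_rfl⟩))))
  have htan' : ∀ᶠ s in 𝓝 t, ∀ x ∈ Icc a b, IsTangency c₁ c₂ s x → s = t := by
    refine isCompact_Icc.eventually_forall_of_forall_eventually fun x _ => ?_
    by_cases hx : x ∈ slice c₁ c₂ t
    · exact htan t x hx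
    · have hneg := (stripFn_neg_iff hlt).2 hx
      filter_upwards [(hφ.continuousAt (x := (t, x))).eventually (gt_mem_nhds hneg)] with p hp hpt
      exact absurd (hpt.mem_slice hlt) ((stripFn_neg_iff hlt).1 hp)
  obtain ⟨ε, hε, H⟩ := Metric.eventually_nhds_iff.1 (hends.and htan')
  have hdist : ∀ s, |s - t| ≤ ε / 2 → dist s t < ε := fun s hs => by
    rw [Real.dist_eq]
    linarith
  refine ⟨a, b, ε / 2, by linarith [ha₀.2], by linarith [hb₀.1], by linarith,
    fun s hs => (H (hdist s hs)).1, fun x hx hxs w hw => (stripFn_nonneg_iff hlt).1 ?_,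
    fun s x hs hx => (H (hdist s hs)).2 x hx⟩
  have hxa : a₀ ≤ x := by
    by_contra hcon
    exact haL x ⟨hx.1, not_le.1 hcon⟩ hxs
  have hxb : x ≤ b₀ := by
    by_contra hcon
    exact hbR x ⟨not_le.1 hcon, hx.2⟩ hxs
  rcases le_total x₀ x with h | h
  · rw [uIcc_of_le h] at hw
    exact hbpos w ⟨hw.1, hw.2.trans hxb⟩
  · rw [uIcc_of_ge h] at hw
    exact hapos w ⟨hxa.trans hw.1, hw.2⟩

/-- There is no gap in a slice between points close to each other, if no critical value of the
boundary curves is close to the level. -/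
theorem Icc_subset_slice (h₁ : Continuous c₁) (h₂ : Continuous c₂) {t ε u v : ℝ}
    (hcv₁ : ∀ w, deriv c₁ w = 0 → |c₁ w - t| < ε → c₁ w = t)
    (hcv₂ : ∀ w, deriv c₂ w = 0 → |c₂ w - t| < ε → c₂ w = t)
    (hclose : ∀ w ∈ Icc u v, c₁ w < t + ε ∧ t - ε < c₂ w) (hu : u ∈ slice c₁ c₂ t)
    (hv : v ∈ slice c₁ c₂ t) : Icc u v ⊆ slice c₁ c₂ t := by
  intro z hz
  by_contra hzs
  have hzs : t < c₁ z ∨ c₂ z < t := by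
    by_contra! hcon
    exact hzs ⟨hcon.1, hcon.2⟩
  rcases hzs with hzt | hzt
  -- A gap forces an interior maximum of `c₁` with critical value strictly between `t` and `t + ε`.
  · obtain ⟨w, hw, hmax⟩ := isCompact_Icc.exists_isMaxOn ⟨z, hz⟩ h₁.continuousOn
    have htw : t < c₁ w := hzt.trans_le (hmax hz)
    have hwu : u ≠ w := by rintro rfl; exact htw.not_ge hu.1
    have hwv : w ≠ v := by rintro rfl; exact htw.not_ge hv.1
    have hd := (hmax.isLocalMax (Icc_mem_nhds (hw.1.lt_of_ne hwu)
      (hw.2.lt_of_ne hwv))).deriv_eq_zero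
    have := (hclose w hw).1
    exact htw.ne' (hcv₁ w hd (by rw [abs_lt]; constructor <;> linarith))
  · obtain ⟨w, hw, hmin⟩ := isCompact_Icc.exists_isMinOn ⟨z, hz⟩ h₂.continuousOn
    have htw : c₂ w < t := (hmin hz : c₂ w ≤ c₂ z).trans_lt hzt
    have hwu : u ≠ w := by rintro rfl; exact htw.not_ge hu.2
    have hwv : w ≠ v := by rintro rfl; exact htw.not_ge hv.2
    have hd := (hmin.isLocalMin (Icc_mem_nhds (hw.1.lt_of_ne hwu)
      (hw.2.lt_of_ne hwv))).deriv_eq_zero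
    have := (hclose w hw).2
    exact htw.ne (hcv₂ w hd (by rw [abs_lt]; constructor <;> linarith))

theorem exists_gap_criticalValues {q₁ q₂ t : ℝ} (ht : t ∉ ({q₁, q₂} : Set ℝ))
    (hclosed : IsClosed (criticalValuesOff c₁ c₂ q₁ q₂))
    (hdiscrete : DiscreteTopology (criticalValuesOff c₁ c₂ q₁ q₂)) :
    ∃ ε > 0, (∀ w, deriv c₁ w = 0 → |c₁ w - t| < ε → c₁ w = t) ∧
      ∀ w, deriv c₂ w = 0 → |c₂ w - t| < ε → c₂ w = t := by
  set T : ({q₁, q₂}ᶜ : Set ℝ) := ⟨t, ht⟩ with hT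
  have hU : ∀ᶠ r in 𝓝 T, r ∈ criticalValuesOff c₁ c₂ q₁ q₂ → r = T := by
    by_cases hTS : T ∈ criticalValuesOff c₁ c₂ q₁ q₂
    · obtain ⟨U, hU, hUS⟩ := (discreteTopology_subtype_iff'.1 hdiscrete) T hTS
      have hTU : T ∈ U := (hUS.symm ▸ mem_singleton T : T ∈ U ∩ _).1
      filter_upwards [hU.mem_nhds hTU] with r hr hrS
      exact (hUS ▸ ⟨hr, hrS⟩ : r ∈ ({T} : Set _))
    · filter_upwards [hclosed.isOpen_compl.mem_nhds hTS] with r hr hrS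
      exact absurd hrS hr
  have hopen : IsOpen ({q₁, q₂}ᶜ : Set ℝ) := (Set.toFinite _).isClosed.isOpen_compl
  have hU' : ∀ᶠ s in 𝓝 t, s ∈ c₁ '' criticalSet c₁ ∪ c₂ '' criticalSet c₂ → s = t := by
    rw [nhds_subtype_eq_comap, eventually_comap] at hU
    filter_upwards [hU, hopen.mem_nhds ht] with s hs hsq hsc
    exact congrArg Subtype.val (hs ⟨s, hsq⟩ rfl hsc)
  obtain ⟨ε, hε, H⟩ := Metric.eventually_nhds_iff.1 hU'
  exact ⟨ε, hε, fun w hw hwt => H (by rwa [Real.dist_eq]) (Or.inl ⟨w, hw, rfl⟩),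
    fun w hw hwt => H (by rwa [Real.dist_eq]) (Or.inr ⟨w, hw, rfl⟩)⟩

theorem eventually_uIcc_subset_slice (h₁ : Continuous c₁) (h₂ : Continuous c₂) {t ε x₁ : ℝ}
    (hε : 0 < ε) (hcv₁ : ∀ w, deriv c₁ w = 0 → |c₁ w - t| < ε → c₁ w = t)
    (hcv₂ : ∀ w, deriv c₂ w = 0 → |c₂ w - t| < ε → c₂ w = t) (hx₁ : x₁ ∈ slice c₁ c₂ t) :
    ∀ᶠ x in 𝓝 x₁, x ∈ slice c₁ c₂ t → uIcc x₁ x ⊆ slice c₁ c₂ t := by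
  have hev : ∀ᶠ w in 𝓝 x₁, c₁ w < t + ε ∧ t - ε < c₂ w :=
    (h₁.continuousAt.eventually (gt_mem_nhds (by linarith [hx₁.1]))).and
      (h₂.continuousAt.eventually (lt_mem_nhds (by linarith [hx₁.2])))
  obtain ⟨r, hr, H⟩ := Metric.eventually_nhds_iff.1 hev
  filter_upwards [Metric.ball_mem_nhds x₁ hr] with x hx hxs
  rw [Metric.mem_ball, Real.dist_eq, abs_lt] at hx
  rcases le_total x₁ x with h | h
  · rw [uIcc_of_le h]
    refine Icc_subset_slice h₁ h₂ hcv₁ hcv₂ (fun w hw => H ?_) hx₁ hxs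
    rw [Real.dist_eq, abs_lt]
    constructor <;> linarith [hw.1, hw.2]
  · rw [uIcc_of_ge h]
    refine Icc_subset_slice h₁ h₂ hcv₁ hcv₂ (fun w hw => H ?_) hxs hx₁
    rw [Real.dist_eq, abs_lt]
    constructor <;> linarith [hw.1, hw.2]

theorem eventually_not_mem_slice {l : Filter ℝ} {q t : ℝ} (hq₁ : Tendsto c₁ l (𝓝 q))
    (hq₂ : Tendsto c₂ l (𝓝 q)) (ht : t ≠ q) : ∀ᶠ x in l, x ∉ slice c₁ c₂ t := by
  rcases ht.lt_or_gt with h | h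
  · filter_upwards [hq₁.eventually (lt_mem_nhds h)] with x hx hxs
    exact hx.not_ge hxs.1
  · filter_upwards [hq₂.eventually (gt_mem_nhds h)] with x hx hxs
    exact hx.not_ge hxs.2

variable {m : ℕ}

theorem lift_mem_of_mem_nhds (h₁ : Continuous c₁) (h₂ : Continuous c₂) (hlt : ∀ x, c₁ x < c₂ x)
    {u : Fin (m - 1) → ℝ} (hu : ∑ j, u j ^ 2 = 1) {p : strip c₁ c₂} {N : Set (manifoldX m c₁ c₂)}
    (hN : N ∈ 𝓝 (lift h₁ h₂ hlt hu p)) :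
    ∀ᶠ r in 𝓝 p.1, ∀ hr : r ∈ strip c₁ c₂, lift h₁ h₂ hlt hu ⟨r, hr⟩ ∈ N := by
  have := (continuous_lift h₁ h₂ hlt hu).continuousAt.preimage_mem_nhds hN
  rw [nhds_subtype_eq_comap, mem_comap] at this
  obtain ⟨W, hW, hWN⟩ := this
  filter_upwards [hW] with r hr hrs
  exact hWN (show (⟨r, hrs⟩ : strip c₁ c₂) ∈ Subtype.val ⁻¹' W from hr)

/-- A slice that contains an unbounded interval has a non-compact contour over it. -/
theorem exists_not_mem_slice_of_isCompact (h₁ : Continuous c₁) (h₂ : Continuous c₂)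
    (hlt : ∀ x, c₁ x < c₂ x) {u : Fin (m - 1) → ℝ} (hu : ∑ j, u j ^ 2 = 1) {p : strip c₁ c₂}
    {N : Set (manifoldX m c₁ c₂)} (hN : IsCompact N)
    (hsub : contour (projX m c₁ c₂) (lift h₁ h₂ hlt hu p) ⊆ N) :
    (∃ a < p.1.2, a ∉ slice c₁ c₂ p.1.1) ∧ ∃ b > p.1.2, b ∉ slice c₁ c₂ p.1.1 := by
  obtain ⟨M, hM⟩ := isBounded_iff_forall_norm_le.1
    (hN.image (by fun_prop : Continuous fun r : manifoldX m c₁ c₂ => r.1.2.1)).isBounded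
  have key : ∀ x, uIcc p.1.2 x ⊆ slice c₁ c₂ p.1.1 → |x| ≤ M := by
    intro x hx
    refine hM x ⟨lift h₁ h₂ hlt hu ⟨(p.1.1, x), hx right_mem_uIcc⟩, hsub ?_, rfl⟩
    rw [contour_lift_eq h₁ h₂ hlt hu (p := p) (q := ⟨(p.1.1, x), hx right_mem_uIcc⟩) rfl hx]
    exact mem_contour _ _
  have hp : p.1.2 ∈ slice c₁ c₂ p.1.1 := p.2
  constructor
  · by_contra! hcon
    have hle : -(|M| + |p.1.2| + 1) ≤ p.1.2 := by
      linarith [neg_abs_le p.1.2, abs_nonneg M]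
    have := key (-(|M| + |p.1.2| + 1)) (by
      rw [uIcc_of_ge hle]
      intro w hw
      rcases hw.2.eq_or_lt with rfl | h
      · exact hp
      · exact hcon w h)
    rw [abs_neg] at this
    linarith [le_abs_self (|M| + |p.1.2| + 1), le_abs_self M, abs_nonneg p.1.2]
  · by_contra! hcon
    have hle : p.1.2 ≤ |M| + |p.1.2| + 1 := by
      linarith [le_abs_self p.1.2, abs_nonneg M]
    have := key (|M| + |p.1.2| + 1) (by
      rw [uIcc_of_le hle]
      intro w hw
      rcases hw.1.eq_or_lt with rfl | h
      · exact hp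
      · exact hcon w h)
    linarith [le_abs_self (|M| + |p.1.2| + 1), le_abs_self M, abs_nonneg p.1.2]

/-- At the levels `q₁`, `q₂` the compact neighbourhood bounds the contour; at any other level the
slice itself is bounded, as both curves converge to `q₁` or `q₂`. -/
theorem exists_not_mem_slice (h₁ : Continuous c₁) (h₂ : Continuous c₂)
    (hlt : ∀ x, c₁ x < c₂ x) {u : Fin (m - 1) → ℝ} (hu : ∑ j, u j ^ 2 = 1) {q₁ q₂ : ℝ}
    (hbot : Tendsto c₁ atBot (𝓝 q₁) ∧ Tendsto c₂ atBot (𝓝 q₁))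
    (htop : Tendsto c₁ atTop (𝓝 q₂) ∧ Tendsto c₂ atTop (𝓝 q₂))
    (hnhds : NeighbourhoodCondition (projX m c₁ c₂) (critX m c₁ c₂) q₁ q₂) (s x : ℝ)
    (hx : x ∈ slice c₁ c₂ s) :
    (∃ a < x, a ∉ slice c₁ c₂ s) ∧ ∃ b > x, b ∉ slice c₁ c₂ s := by
  by_cases hs : s = q₁ ∨ s = q₂
  · obtain ⟨N, hN, -⟩ := hnhds
    obtain ⟨hN1, hN2, -⟩ := hN _ ⟨lift h₁ h₂ hlt hu ⟨(s, x), hx⟩, hs, rfl⟩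
    exact exists_not_mem_slice_of_isCompact h₁ h₂ hlt hu (p := ⟨(s, x), hx⟩) hN2
      (subset_of_mem_nhdsSet hN1)
  · rw [not_or] at hs
    obtain ⟨a, ha, ha'⟩ := ((eventually_not_mem_slice hbot.1 hbot.2 hs.1).and
      (eventually_lt_atBot x)).exists
    obtain ⟨b, hb, hb'⟩ := ((eventually_not_mem_slice htop.1 htop.2 hs.2).and
      (eventually_gt_atTop x)).exists
    exact ⟨⟨a, ha', ha⟩, b, hb', hb⟩

/-- At the levels `q₁`, `q₂`, disjointness of the neighbourhoods isolates the components, and the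
absence of critical contours in `N K \ K` excludes tangencies at other levels. Elsewhere both follow
from a gap in the critical values. -/
theorem hasBoxes (hc₁ : ContDiff ℝ ∞ c₁) (hc₂ : ContDiff ℝ ∞ c₂)
    (hlt : ∀ x, c₁ x < c₂ x) {u : Fin (m - 1) → ℝ} (hu : ∑ j, u j ^ 2 = 1) {q₁ q₂ : ℝ}
    (hclosed : IsClosed (criticalValuesOff c₁ c₂ q₁ q₂))
    (hdiscrete : DiscreteTopology (criticalValuesOff c₁ c₂ q₁ q₂))
    (hbot : Tendsto c₁ atBot (𝓝 q₁) ∧ Tendsto c₂ atBot (𝓝 q₁))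
    (htop : Tendsto c₁ atTop (𝓝 q₂) ∧ Tendsto c₂ atTop (𝓝 q₂))
    (hnhds : NeighbourhoodCondition (projX m c₁ c₂) (critX m c₁ c₂) q₁ q₂) :
    HasBoxes c₁ c₂ := by
  have h₁ := hc₁.continuous
  have h₂ := hc₂.continuous
  have hbd := exists_not_mem_slice h₁ h₂ hlt hu hbot htop hnhds
  refine hasBoxes_of_local h₁ h₂ hlt (fun s x hx => (hbd s x hx).1) (fun s x hx => (hbd s x hx).2)
    (fun t x₁ hx₁ => ?_) fun t x₁ hx₁ => ?_
  · by_cases ht : t = q₁ ∨ t = q₂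
    · obtain ⟨N, hN, hdisj⟩ := hnhds
      set K := contour (projX m c₁ c₂) (lift h₁ h₂ hlt hu ⟨(t, x₁), hx₁⟩) with hK
      have hKm : ∃ x, (projX m c₁ c₂ x = q₁ ∨ projX m c₁ c₂ x = q₂) ∧ K = contour _ x :=
        ⟨lift h₁ h₂ hlt hu ⟨(t, x₁), hx₁⟩, ht, rfl⟩
      have hNK := mem_nhdsSet_iff_forall.1 (hN K hKm).1 _ (mem_contour _ _)
      have hev := lift_mem_of_mem_nhds h₁ h₂ hlt hu hNK
      have hcont : Continuous fun x : ℝ => (t, x) := by fun_prop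
      filter_upwards [hcont.continuousAt.eventually hev] with x hx hxs
      have hK'm : ∃ y, (projX m c₁ c₂ y = q₁ ∨ projX m c₁ c₂ y = q₂) ∧
          contour (projX m c₁ c₂) (lift h₁ h₂ hlt hu ⟨(t, x), hxs⟩) = contour (projX m c₁ c₂) y :=
        ⟨lift h₁ h₂ hlt hu ⟨(t, x), hxs⟩, ht, rfl⟩
      have hKK' : K = contour (projX m c₁ c₂) (lift h₁ h₂ hlt hu ⟨(t, x), hxs⟩) := by
        by_contra hne
        refine disjoint_left.1 (hdisj _ _ hKm hK'm hne) (hx hxs) ?_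
        exact subset_of_mem_nhdsSet (hN _ hK'm).1 (mem_contour _ _)
      exact (uIcc_subset_of_contour_eq h₁ h₂ hlt hKK').2
    · obtain ⟨ε, hε, hcv₁, hcv₂⟩ := exists_gap_criticalValues (t := t) ht hclosed hdiscrete
      exact eventually_uIcc_subset_slice h₁ h₂ hε hcv₁ hcv₂ hx₁
  · by_cases ht : t = q₁ ∨ t = q₂
    · obtain ⟨N, hN, -⟩ := hnhds
      obtain ⟨hN1, -, -, -, -, hN2⟩ := hN _ ⟨lift h₁ h₂ hlt hu ⟨(t, x₁), hx₁⟩, ht, rfl⟩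
      have hNK := mem_nhdsSet_iff_forall.1 hN1 _ (mem_contour _ _)
      filter_upwards [lift_mem_of_mem_nhds h₁ h₂ hlt hu hNK] with r hr hrt
      have hrs : r ∈ strip c₁ c₂ := hrt.mem_slice hlt
      have hcrit : lift h₁ h₂ hlt hu ⟨r, hrs⟩ ∈ critX m c₁ c₂ := mem_critX_of_isTangency
        (hc₁.differentiable (by simp)) (hc₂.differentiable (by simp)) hlt hrt
      by_contra hne
      refine disjoint_left.1 hN2 ⟨hr hrs, fun hmem => hne ?_⟩ hcrit
      exact level_eq_of_mem_contour hmem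
    · obtain ⟨ε, hε, hcv₁, hcv₂⟩ := exists_gap_criticalValues (t := t) ht hclosed hdiscrete
      have hev : ∀ᶠ p : ℝ × ℝ in 𝓝 (t, x₁), p.1 ∈ Metric.ball t ε :=
        continuous_fst.continuousAt.eventually (Metric.ball_mem_nhds t hε)
      filter_upwards [hev] with p hp hpt
      rw [Metric.mem_ball, Real.dist_eq] at hp
      rcases hpt with ⟨hs, hd⟩ | ⟨hs, hd⟩
      · exact hs ▸ hcv₁ p.2 hd (hs.symm ▸ hp)
      · exact hs ▸ hcv₂ p.2 hd (hs.symm ▸ hp)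

end Boxes

/-! ### The four conditions at the two ends. -/

section Conditions

variable {c c₁ c₂ : ℝ → ℝ}

theorem lt_of_strictAntiOn_Ici {b q x : ℝ} (h : StrictAntiOn c (Ici b))
    (hq : Tendsto c atTop (𝓝 q)) (hx : b ≤ x) : q < c x := by
  have h1 : c (x + 1) < c x := h hx (show b ≤ x + 1 by linarith) (by linarith)
  refine lt_of_le_of_lt (le_of_tendsto hq ?_) h1
  filter_upwards [eventually_ge_atTop (x + 1)] with y hy
  exact h.antitoneOn (show b ≤ x + 1 by linarith) (show b ≤ y by linarith) hy

theorem lt_of_strictMonoOn_Iic {b q x : ℝ} (h : StrictMonoOn c (Iic b))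
    (hq : Tendsto c atBot (𝓝 q)) (hx : x ≤ b) : q < c x := by
  have h1 : c (x - 1) < c x := h (show x - 1 ≤ b by linarith) hx (by linarith)
  refine lt_of_le_of_lt (le_of_tendsto hq ?_) h1
  filter_upwards [eventually_le_atBot (x - 1)] with y hy
  exact h.monotoneOn (show y ≤ b by linarith) (show x - 1 ≤ b by linarith) hy

theorem strictMonoOn_or_strictAntiOn {S : Set ℝ} (hS : Convex ℝ S) (hc : Differentiable ℝ c)
    (h : ∀ x ∈ S, deriv c x ≠ 0) : StrictMonoOn c S ∨ StrictAntiOn c S := by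
  rcases hasDerivWithinAt_forall_lt_or_forall_gt_of_forall_ne hS
    (fun x _ => (hc x).hasDerivAt.hasDerivWithinAt) h with h' | h'
  · exact Or.inr (strictAntiOn_of_deriv_neg hS hc.continuous.continuousOn
      fun x hx => h' x (interior_subset hx))
  · exact Or.inl (strictMonoOn_of_deriv_pos hS hc.continuous.continuousOn
      fun x hx => h' x (interior_subset hx))

theorem exists_forall_ge_deriv_ne_zero (h₁ : BddAbove (criticalSet c₁))
    (h₂ : BddAbove (criticalSet c₂)) : ∃ b, ∀ x ∈ Ici b, deriv c₁ x ≠ 0 ∧ deriv c₂ x ≠ 0 := by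
  obtain ⟨b₁, hb₁⟩ := h₁
  obtain ⟨b₂, hb₂⟩ := h₂
  refine ⟨max b₁ b₂ + 1, fun x (hx : _ ≤ x) => ⟨fun h => ?_, fun h => ?_⟩⟩
  · linarith [hb₁ h, le_max_left b₁ b₂]
  · linarith [hb₂ h, le_max_right b₁ b₂]

theorem exists_forall_le_deriv_ne_zero (h₁ : BddBelow (criticalSet c₁))
    (h₂ : BddBelow (criticalSet c₂)) : ∃ b, ∀ x ∈ Iic b, deriv c₁ x ≠ 0 ∧ deriv c₂ x ≠ 0 := by
  obtain ⟨b₁, hb₁⟩ := h₁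
  obtain ⟨b₂, hb₂⟩ := h₂
  refine ⟨min b₁ b₂ - 1, fun x (hx : x ≤ _) => ⟨fun h => ?_, fun h => ?_⟩⟩
  · linarith [hb₁ h, min_le_left b₁ b₂]
  · linarith [hb₂ h, min_le_right b₁ b₂]

theorem bddAbove_criticalSet (h : ∀ᶠ x in atTop, deriv c x ≠ 0) : BddAbove (criticalSet c) := by
  obtain ⟨b, hb⟩ := eventually_atTop.1 h
  exact ⟨b, fun x hx => le_of_not_ge fun hbx => hb x hbx hx⟩

theorem bddBelow_criticalSet (h : ∀ᶠ x in atBot, deriv c x ≠ 0) : BddBelow (criticalSet c) := by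
  obtain ⟨b, hb⟩ := eventually_atBot.1 h
  exact ⟨b, fun x hx => le_of_not_ge fun hbx => hb x hbx hx⟩

theorem isBounded_range_of_tendsto (hc : Continuous c) {q₁ q₂ : ℝ} (hbot : Tendsto c atBot (𝓝 q₁))
    (htop : Tendsto c atTop (𝓝 q₂)) : Bornology.IsBounded (range c) := by
  obtain ⟨a, ha⟩ := eventually_atBot.1 (hbot.eventually (Metric.ball_mem_nhds q₁ one_pos))
  obtain ⟨b, hb⟩ := eventually_atTop.1 (htop.eventually (Metric.ball_mem_nhds q₂ one_pos))
  refine ((Metric.isBounded_ball (x := q₁) (r := 1)).union ((Metric.isBounded_ball (x := q₂)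
    (r := 1)).union (isCompact_Icc (a := a) (b := b) |>.image hc).isBounded)).subset ?_
  rintro _ ⟨x, rfl⟩
  rcases le_total x a with h | h
  · exact Or.inl (ha x h)
  rcases le_total b x with h' | h'
  · exact Or.inr (Or.inl (hb x h'))
  · exact Or.inr (Or.inr ⟨x, ⟨h, h'⟩, rfl⟩)

namespace IsSliceQuotient

variable {Y : Type*} [TopologicalSpace Y] {ρ : strip c₁ c₂ → Y} {f : Y → ℝ} {κ : ℝ → ℝ}

/-- By `hout` the component through `(κ x, x)` cannot extend to the left of `x`; it stays where no
curve has critical points, and `exists_not_isCompact_closure` applies. -/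
theorem exists_not_isCompact_atTop (h : IsSliceQuotient ρ f) (hbox : HasBoxes c₁ c₂)
    (hκ : Continuous κ) (hmem : ∀ x, x ∈ slice c₁ c₂ (κ x)) {b : ℝ}
    (hd : ∀ x ∈ Ici b, deriv c₁ x ≠ 0 ∧ deriv c₂ x ≠ 0)
    (hout : ∀ x ∈ Ici b, ∀ w ∈ Ico b x, w ∉ slice c₁ c₂ (κ x)) :
    ∃ e ∈ edges (ρ '' {p | IsTangency c₁ c₂ p.1.1 p.1.2}), ¬ IsCompact (closure e) := by
  refine h.exists_not_isCompact_closure hbox hκ hmem (l := atTop) (Q := Ioi b)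
    (fun a' b' => ?_) (Ioi_mem_atTop b) isPreconnected_Ioi fun x hx z hz htan => ?_
  · filter_upwards [eventually_gt_atTop b'] with x hx hx'
    exact hx.not_ge hx'.2
  · have hx : b < x := hx
    rcases le_or_gt x z with hxz | hxz
    · have := hd z (show b ≤ z by linarith)
      rcases htan with htan | htan
      · exact this.1 htan.2
      · exact this.2 htan.2
    · refine hout x hx.le (max z b) ⟨le_max_right _ _, max_lt hxz hx⟩ (hz ?_)
      rw [uIcc_of_ge hxz.le]
      exact ⟨le_max_left _ _, (max_lt hxz hx).le⟩

theorem exists_not_isCompact_atBot (h : IsSliceQuotient ρ f) (hbox : HasBoxes c₁ c₂)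
    (hκ : Continuous κ) (hmem : ∀ x, x ∈ slice c₁ c₂ (κ x)) {b : ℝ}
    (hd : ∀ x ∈ Iic b, deriv c₁ x ≠ 0 ∧ deriv c₂ x ≠ 0)
    (hout : ∀ x ∈ Iic b, ∀ w ∈ Ioc x b, w ∉ slice c₁ c₂ (κ x)) :
    ∃ e ∈ edges (ρ '' {p | IsTangency c₁ c₂ p.1.1 p.1.2}), ¬ IsCompact (closure e) := by
  refine h.exists_not_isCompact_closure hbox hκ hmem (l := atBot) (Q := Iio b)
    (fun a' b' => ?_) (Iio_mem_atBot b) isPreconnected_Iio fun x hx z hz htan => ?_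
  · filter_upwards [eventually_lt_atBot a'] with x hx hx'
    exact hx.not_ge hx'.1
  · have hx : x < b := hx
    rcases le_or_gt z x with hxz | hxz
    · have := hd z (show z ≤ b by linarith)
      rcases htan with htan | htan
      · exact this.1 htan.2
      · exact this.2 htan.2
    · refine hout x hx.le (min z b) ⟨lt_min hxz hx, min_le_right _ _⟩ (hz ?_)
      rw [uIcc_of_le hxz.le]
      exact ⟨(lt_min hxz hx).le, min_le_left _ _⟩

/-- All edges have compact closure if and only if near `±∞` the boundary curves do not run together
to the limiting level, without critical points and from the same side. -/
theorem forall_isCompact_closure_iff (h : IsSliceQuotient ρ f) (hc₁ : ContDiff ℝ ∞ c₁)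
    (hc₂ : ContDiff ℝ ∞ c₂) (hlt : ∀ x, c₁ x < c₂ x) (hbox : HasBoxes c₁ c₂) {q₁ q₂ : ℝ}
    (hbot : Tendsto c₁ atBot (𝓝 q₁) ∧ Tendsto c₂ atBot (𝓝 q₁))
    (htop : Tendsto c₁ atTop (𝓝 q₂) ∧ Tendsto c₂ atTop (𝓝 q₂))
    (hb : BddBelow (range f)) (ha : BddAbove (range f)) :
    (∀ e ∈ edges (ρ '' {p | IsTangency c₁ c₂ p.1.1 p.1.2}), IsCompact (closure e)) ↔
      (¬ BddBelow (criticalSet c₂) ∨ (∃ b, StrictMonoOn c₂ (Iic b)) ∨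
        ¬ BddBelow (criticalSet c₁)) ∧
      (¬ BddAbove (criticalSet c₂) ∨ (∃ b, StrictAntiOn c₂ (Ici b)) ∨
        ¬ BddAbove (criticalSet c₁)) ∧
      (¬ BddBelow (criticalSet c₁) ∨ (∃ b, StrictMonoOn (-c₁) (Iic b)) ∨
        ¬ BddBelow (criticalSet c₂)) ∧
      (¬ BddAbove (criticalSet c₁) ∨ (∃ b, StrictAntiOn (-c₁) (Ici b)) ∨
        ¬ BddAbove (criticalSet c₂)) := by
  have h₁ := hc₁.continuous
  have h₂ := hc₂.continuous
  have d₁ : Differentiable ℝ c₁ := hc₁.differentiable (by simp)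
  have d₂ : Differentiable ℝ c₂ := hc₂.differentiable (by simp)
  have hm₁ : ∀ x, x ∈ slice c₁ c₂ (c₁ x) := fun x => ⟨le_rfl, (hlt x).le⟩
  have hm₂ : ∀ x, x ∈ slice c₁ c₂ (c₂ x) := fun x => ⟨(hlt x).le, le_rfl⟩
  constructor
  · intro hcpt
    have hno : ¬ ∃ e ∈ edges (ρ '' {p | IsTangency c₁ c₂ p.1.1 p.1.2}),
        ¬ IsCompact (closure e) := fun ⟨e, he, hne⟩ => hne (hcpt e he)
    refine ⟨?_, ?_, ?_, ?_⟩ <;> by_contra! hcon <;> apply hno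
    · obtain ⟨b, hd⟩ := exists_forall_le_deriv_ne_zero hcon.2.2 hcon.1
      -- Without critical points `c₂` is strictly monotone, so here it decreases. Then `c₂ w < c₂ x`
      -- for `x < w ≤ b`, and the slice at level `c₂ x` has no points in `(x, b]`. The other three
      -- cases are mirror images.
      have hmono := (strictMonoOn_or_strictAntiOn (convex_Iic b) d₂
        fun x hx => (hd x hx).2).resolve_left (hcon.2.1 b)
      exact h.exists_not_isCompact_atBot hbox h₂ hm₂ hd fun x hx w hw hws =>
        (hmono hx hw.2 hw.1).not_ge hws.2
    · obtain ⟨b, hd⟩ := exists_forall_ge_deriv_ne_zero hcon.2.2 hcon.1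
      have hmono := (strictMonoOn_or_strictAntiOn (convex_Ici b) d₂
        fun x hx => (hd x hx).2).resolve_right (hcon.2.1 b)
      exact h.exists_not_isCompact_atTop hbox h₂ hm₂ hd fun x hx w hw hws =>
        (hmono hw.1 hx hw.2).not_ge hws.2
    · obtain ⟨b, hd⟩ := exists_forall_le_deriv_ne_zero hcon.1 hcon.2.2
      have hmono := (strictMonoOn_or_strictAntiOn (convex_Iic b) d₁
        fun x hx => (hd x hx).1).resolve_right fun hanti => hcon.2.1 b hanti.neg
      exact h.exists_not_isCompact_atBot hbox h₁ hm₁ hd fun x hx w hw hws =>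
        (hmono hx hw.2 hw.1).not_ge hws.1
    · obtain ⟨b, hd⟩ := exists_forall_ge_deriv_ne_zero hcon.1 hcon.2.2
      have hmono := (strictMonoOn_or_strictAntiOn (convex_Ici b) d₁
        fun x hx => (hd x hx).1).resolve_left fun hm => hcon.2.1 b hm.neg
      exact h.exists_not_isCompact_atTop hbox h₁ hm₁ hd fun x hx w hw hws =>
        (hmono hw.1 hx hw.2).not_ge hws.1
  · rintro ⟨k1, k2, k3, k4⟩ e he
    by_contra hne
    have := h.t2Space h₁ h₂ hlt
    have hL := h.isLevelFunction hc₁ hc₂ hlt hbox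
    obtain ⟨β, hβ, hβ'⟩ := hL.exists_end_of_not_isCompact hb ha he hne
    have hfreq := fun {ε : ℝ} (hε : 0 < ε) =>
      h.frequently_cocompact hL.continuous h₁ h₂ hβ hβ' hε
    by_cases hside : ∀ ε > 0, ∃ᶠ x in atTop, ∃ p : strip c₁ c₂, p.1.2 = x ∧ ρ p ∈ e ∧
        |p.1.1 - β| < ε
    · obtain ⟨r₁, r₂, hr⟩ := h.exists_regular_end hL h₁ h₂ hlt he hβ hβ' (l := atTop) (by
        intro S hS
        obtain ⟨b, hb⟩ := mem_atTop_sets.1 hS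
        exact ⟨Ici b, Ici_mem_atTop b, hb, isPreconnected_Ici⟩) htop.1 htop.2 hside
      rcases hr with hr | hr
      · rcases k2 with k | ⟨b, k⟩ | k
        · exact k (bddAbove_criticalSet r₂)
        · obtain ⟨x, hx, hbx⟩ := (hr.and (eventually_ge_atTop b)).exists
          exact hx.not_gt (lt_of_strictAntiOn_Ici k htop.2 hbx)
        · exact k (bddAbove_criticalSet r₁)
      · rcases k4 with k | ⟨b, k⟩ | k
        · exact k (bddAbove_criticalSet r₁)
        · obtain ⟨x, hx, hbx⟩ := (hr.and (eventually_ge_atTop b)).exists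
          exact hx.not_gt (neg_lt_neg_iff.1 (lt_of_strictAntiOn_Ici (c := -c₁) k htop.1.neg hbx))
        · exact k (bddAbove_criticalSet r₂)
    -- If the edge does not approach `β` within `ε₀` near `+∞`, then its approaches within `min ε
    -- ε₀` happen near `-∞`.
    · push Not at hside
      obtain ⟨ε₀, hε₀, hnot⟩ := hside
      obtain ⟨r₁, r₂, hr⟩ := h.exists_regular_end hL h₁ h₂ hlt he hβ hβ' (l := atBot) (by
        intro S hS
        obtain ⟨b, hb⟩ := mem_atBot_sets.1 hS
        exact ⟨Iic b, Iic_mem_atBot b, hb, isPreconnected_Iic⟩) hbot.1 hbot.2 (by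
          intro ε hε
          rcases frequently_sup.1 (hfreq (lt_min hε hε₀)) with hf | hf
          · refine hf.mono ?_
            rintro x ⟨p, hp, hpe, hpβ⟩
            exact ⟨p, hp, hpe, hpβ.trans_le (min_le_left _ _)⟩
          · obtain ⟨x, ⟨p, hp, hpe, hpβ⟩, hx⟩ := (hf.and_eventually hnot).exists
            exact absurd (hpβ.trans_le (min_le_right _ _)) (hx p hp hpe).not_gt)
      rcases hr with hr | hr
      · rcases k1 with k | ⟨b, k⟩ | k
        · exact k (bddBelow_criticalSet r₂)
        · obtain ⟨x, hx, hbx⟩ := (hr.and (eventually_le_atBot b)).exists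
          exact hx.not_gt (lt_of_strictMonoOn_Iic k hbot.2 hbx)
        · exact k (bddBelow_criticalSet r₁)
      · rcases k3 with k | ⟨b, k⟩ | k
        · exact k (bddBelow_criticalSet r₁)
        · obtain ⟨x, hx, hbx⟩ := (hr.and (eventually_le_atBot b)).exists
          exact hx.not_gt (neg_lt_neg_iff.1 (lt_of_strictMonoOn_Iic (c := -c₁) k hbot.1.neg hbx))
        · exact k (bddBelow_criticalSet r₂)

end IsSliceQuotient

/-- The first two conjuncts of the last alternative only negate the preceding alternatives, so they
can be dropped. -/
theorem or_and_not_iff {P R : Prop} {S : ℝ → Prop} :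
    (¬ P ∨ ∃ b, S b) ∨ (P ∧ (∀ b, ¬ S b) ∧ ¬ R) ↔ ¬ P ∨ (∃ b, S b) ∨ ¬ R := by
  rw [← not_exists]
  tauto

end Conditions

end ReebStrip

theorem theorem3 (m : ℕ) (hm : 2 ≤ m) (c₁ c₂ : ℝ → ℝ)
    (hc₁ : ContDiff ℝ ∞ c₁) (hc₂ : ContDiff ℝ ∞ c₂) (hlt : ∀ x, c₁ x < c₂ x)
    (q₁ q₂ : ℝ)
    (hclosed : IsClosed (ReebStrip.criticalValuesOff c₁ c₂ q₁ q₂))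
    (hdiscrete : DiscreteTopology (ReebStrip.criticalValuesOff c₁ c₂ q₁ q₂))
    (hcrit : (ReebStrip.criticalSet c₁ ∪ ReebStrip.criticalSet c₂).Nonempty)
    (hbot : Tendsto c₁ atBot (𝓝 q₁) ∧ Tendsto c₂ atBot (𝓝 q₁))
    (htop : Tendsto c₁ atTop (𝓝 q₂) ∧ Tendsto c₂ atTop (𝓝 q₂))
    (hnhds : ReebStrip.NeighbourhoodCondition (ReebStrip.projX m c₁ c₂)
      (ReebStrip.critX m c₁ c₂) q₁ q₂) :
    ReebStrip.IsGraphWithEnds (ReebStrip.ReebSpace (ReebStrip.projX m c₁ c₂))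
        (ReebStrip.contoursMeeting (ReebStrip.projX m c₁ c₂) (ReebStrip.critX m c₁ c₂)) ∧
      (ReebStrip.IsIsomorphicToGraph (ReebStrip.ReebSpace (ReebStrip.projX m c₁ c₂))
          (ReebStrip.contoursMeeting (ReebStrip.projX m c₁ c₂) (ReebStrip.critX m c₁ c₂)) ↔
        ((¬ BddBelow (ReebStrip.criticalSet c₂) ∨ ∃ b, StrictMonoOn c₂ (Iic b)) ∨
          (BddBelow (ReebStrip.criticalSet c₂) ∧ (∀ b, ¬ StrictMonoOn c₂ (Iic b)) ∧
            ¬ BddBelow (ReebStrip.criticalSet c₁))) ∧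
        ((¬ BddAbove (ReebStrip.criticalSet c₂) ∨ ∃ b, StrictAntiOn c₂ (Ici b)) ∨
          (BddAbove (ReebStrip.criticalSet c₂) ∧ (∀ b, ¬ StrictAntiOn c₂ (Ici b)) ∧
            ¬ BddAbove (ReebStrip.criticalSet c₁))) ∧
        ((¬ BddBelow (ReebStrip.criticalSet c₁) ∨ ∃ b, StrictMonoOn (-c₁) (Iic b)) ∨
          (BddBelow (ReebStrip.criticalSet c₁) ∧ (∀ b, ¬ StrictMonoOn (-c₁) (Iic b)) ∧
            ¬ BddBelow (ReebStrip.criticalSet c₂))) ∧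
        ((¬ BddAbove (ReebStrip.criticalSet c₁) ∨ ∃ b, StrictAntiOn (-c₁) (Ici b)) ∨
          (BddAbove (ReebStrip.criticalSet c₁) ∧ (∀ b, ¬ StrictAntiOn (-c₁) (Ici b)) ∧
            ¬ BddAbove (ReebStrip.criticalSet c₂)))) := by
  have h₁ := hc₁.continuous
  have h₂ := hc₂.continuous
  -- A unit vector exists because `m ≥ 2` makes the fibre space non-trivial.
  obtain ⟨u, hu⟩ : ∃ u : Fin (m - 1) → ℝ, ∑ j, u j ^ 2 = 1 :=
    ⟨Pi.single ⟨0, by omega⟩ 1, by simp [Pi.single_apply, ite_pow]⟩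
  have hbox := ReebStrip.hasBoxes hc₁ hc₂ hlt hu hclosed hdiscrete hbot htop hnhds
  have hbd := fun s x hx =>
    (ReebStrip.exists_not_mem_slice h₁ h₂ hlt hu hbot htop hnhds s x hx).2
  have hS := ReebStrip.isSliceQuotient_toReeb h₁ h₂ hlt hbd hu
  have hL := hS.isLevelFunction hc₁ hc₂ hlt hbox
  have := hS.t2Space h₁ h₂ hlt
  have := hS.connectedSpace h₁ h₂ hlt
  have hm₁ : ∀ x, (c₁ x, x) ∈ ReebStrip.strip c₁ c₂ := fun x => ⟨le_rfl, (hlt x).le⟩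
  have hm₂ : ∀ x, (c₂ x, x) ∈ ReebStrip.strip c₁ c₂ := fun x => ⟨(hlt x).le, le_rfl⟩
  have hb : BddBelow (range (ReebStrip.reebLevel (ReebStrip.projX m c₁ c₂))) := by
    obtain ⟨M, hM⟩ := (ReebStrip.isBounded_range_of_tendsto h₁ hbot.1 htop.1).bddBelow
    refine ⟨M, ?_⟩
    rintro _ ⟨y, rfl⟩
    obtain ⟨p, rfl⟩ := hS.isQuotientMap.surjective y
    exact (hM ⟨p.1.2, rfl⟩).trans p.2.1
  have ha : BddAbove (range (ReebStrip.reebLevel (ReebStrip.projX m c₁ c₂))) := by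
    obtain ⟨M, hM⟩ := (ReebStrip.isBounded_range_of_tendsto h₂ hbot.2 htop.2).bddAbove
    refine ⟨M, ?_⟩
    rintro _ ⟨y, rfl⟩
    obtain ⟨p, rfl⟩ := hS.isQuotientMap.surjective y
    exact p.2.2.trans (hM ⟨p.1.2, rfl⟩)
  have hV : (ReebStrip.toReeb h₁ h₂ hlt hu ''
      {p | ReebStrip.IsTangency c₁ c₂ p.1.1 p.1.2}).Nonempty := by
    obtain ⟨x, hx | hx⟩ := hcrit
    · exact ⟨_, ⟨(c₁ x, x), hm₁ x⟩, Or.inl ⟨rfl, hx⟩, rfl⟩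
    · exact ⟨_, ⟨(c₂ x, x), hm₂ x⟩, Or.inr ⟨rfl, hx⟩, rfl⟩
  have hends := hL.isGraphWithEnds hV hb ha (y := ReebStrip.toReeb h₁ h₂ hlt hu ⟨_, hm₁ 0⟩)
    (z := ReebStrip.toReeb h₁ h₂ hlt hu ⟨_, hm₂ 0⟩) (hlt 0).ne
  rw [ReebStrip.contoursMeeting_critX hc₁ hc₂ hlt hbd hu]
  refine ⟨hends, ?_⟩
  simp only [ReebStrip.or_and_not_iff]
  rw [← hS.forall_isCompact_closure_iff hc₁ hc₂ hlt hbox hbot htop hb ha]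
  constructor
  · intro hG e he
    exact hG.isCompact_closure he
  · intro hcpt
    exact ⟨_, _, _, hends.isGraph hcpt, Homeomorph.refl _, image_id _⟩
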